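/- Let $B\subset\mathbb R^3$ be a bounded open set whose boundary $\Gamma$ has Lebesgue measure zero (for example a bounded Lipschitz domain), with outward normal $\boldsymbol n$, and put $B^c=\mathbb R^3\setminus\overline B$. Let $k,\alpha,\mu_r>0$ and $\epsilon_r\in\mathbb C$ with $\operatorname{Re}\epsilon_r>0$, $\operatorname{Im}\epsilon_r\ge 0$ (wave number, size, relative permeability and complex relative permittivity of the object $B_\alpha=\alpha B+\boldsymbol z$). Put $\nu=\alpha^2k^2(\epsilon_r-1)$, and let $\tilde\mu_r=\mu_r$ in $B$, $\tilde\mu_r=1$ in $B^c$. Write $[\cdot]_\Gamma=\cdot|_+-\cdot|_-$ (outer minus inner value). For $i=1,2,3$ let $\boldsymbol\theta_i$ be a solution, in $H_{\rm loc}(\mathrm{curl})$ and with weak derivatives and tangential traces, of $$\nabla\times\mu_r^{-1}\nabla\times\boldsymbol\theta_i-k^2\alpha^2\epsilon_r\boldsymbol\theta_i=-k^2\alpha^2(1-\epsilon_r)\,\boldsymbol e_i\times\boldsymbol\xi\ \text{ in }B,\qquad \nabla\times\nabla\times\boldsymbol\theta_i-k^2\alpha^2\boldsymbol\theta_i=\boldsymbol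 0\ \text{ in }B^c,$$ $$\nabla\cdot\boldsymbol\theta_i=0\ \text{ in }B\text{ and in }B^c,\qquad [\boldsymbol n\times\boldsymbol\theta_i]_\Gamma=\boldsymbol 0,\qquad [\boldsymbol n\times\tilde\mu_r^{-1}\nabla\times\boldsymbol\theta_i]_\Gamma=-2(1-\mu_r^{-1})\,\boldsymbol n\times\boldsymbol e_i,$$ $$\lim_{|\boldsymbol\xi|\to\infty}|\boldsymbol\xi|\big((\nabla\times\boldsymbol\theta_i)\times\hat{\boldsymbol\xi}-\mathrm i k\alpha\,\boldsymbol\theta_i\big)=\boldsymbol 0\quad\text{uniformly in the direction }\hat{\boldsymbol\xi}=\boldsymbol\xi/|\boldsymbol\xi|.$$ Define $$\mathcal N_{ri}=\alpha^3(1-\mu_r^{-1})\,\boldsymbol e_r\cdot\int_B\Big(\boldsymbol e_i+\tfrac12\nabla\times\boldsymbol\theta_i\Big)d\boldsymbol\xi,\qquad \check{\mathcal C}_{ri}=-\frac{\nu\alpha^3}{4}\,\boldsymbol e_r\cdot\int_B\boldsymbol\xi\times(\boldsymbol\theta_i+\boldsymbol e_i\times\boldsymbol\xi)\,d\boldsymbol\xi,\qquad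 \mathcal M=\mathcal N-\check{\mathcal C}.$$ **(1)** The tensor $\mathcal M$ is complex symmetric: $\mathcal M_{ri}=\mathcal M_{ir}$ for all $r,i\in\{1,2,3\}$. **(2)** For $i=1,2,3$ let moreover $\boldsymbol\phi_i$ solve the same transmission problem with right-hand side $-k^2\alpha^2(1-\epsilon_r)\boldsymbol e_i$ in $B$ and with $[\boldsymbol n\times\tilde\mu_r^{-1}\nabla\times\boldsymbol\phi_i]_\Gamma=\boldsymbol 0$. Let $$\mathcal A_{ri}=\frac{\mathrm i k\alpha^4(\epsilon_r-1)}{2}\boldsymbol e_r\cdot\int_B(\boldsymbol e_i\times\boldsymbol\xi+\boldsymbol\theta_i)\,d\boldsymbol\xi,\quad \mathcal B_{ri}=\alpha^3(\epsilon_r-1)\,\boldsymbol e_r\cdot\int_B(\boldsymbol e_i+\boldsymbol\phi_i)\,d\boldsymbol\xi,$$ $$\mathcal C_{msi}=-\frac{k^2\alpha^5(\epsilon_r-1)}{2}\boldsymbol e_s\cdot\int_B\xi_m(\boldsymbol e_i\times\boldsymbol\xi+\boldsymbol\theta_i)\,d\boldsymbol\xi,\qquad R_{msi}=\mathcal C_{msi}-\varepsilon_{msr}\check{\mathcal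 C}_{ri},$$ with summation over repeated indices and $\varepsilon$ the Levi-Civita symbol, and let $G_k(\boldsymbol x,\boldsymbol z)=e^{\mathrm i k|\boldsymbol x-\boldsymbol z|}/(4\pi|\boldsymbol x-\boldsymbol z|)$. Let $\boldsymbol x\ne\boldsymbol z$ be points of $\mathbb R^3$, $r=|\boldsymbol x-\boldsymbol z|$, $\hat{\boldsymbol r}=(\boldsymbol x-\boldsymbol z)/r$, and let $\boldsymbol H_0,\boldsymbol E_0,\boldsymbol H_\Delta,\boldsymbol R\in\mathbb C^3$ (the background fields at $\boldsymbol z$, the perturbed magnetic field at $\boldsymbol x$ and a residual). Then the expansion $$(\boldsymbol H_\Delta)_j=-\mathrm i k(\nabla_xG_k)_p\,\varepsilon_{jpr}\big(\mathcal A_{ri}(\boldsymbol H_0)_i+\mathcal B_{ri}(\boldsymbol E_0)_i\big)+(\boldsymbol D_x^2G_k)_{\ell m}\varepsilon_{j\ell s}\mathcal C_{msi}(\boldsymbol H_0)_i+\big((\boldsymbol D_x^2G_k)_{jr}+k^2\delta_{jr}G_k\big)\mathcal N_{ri}(\boldsymbol H_0)_i+(\boldsymbol R)_j$$ holds for $j=1,2,3$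 if and only if $$\boldsymbol H_\Delta=\frac{e^{\mathrm i kr}}{4\pi}\Big\{\frac1{r^3}\big(3(\hat{\boldsymbol r}\cdot\mathcal M\boldsymbol H_0)\hat{\boldsymbol r}-\mathcal M\boldsymbol H_0\big)-\frac{\mathrm i k}{r^2}\big(3(\hat{\boldsymbol r}\cdot\mathcal M\boldsymbol H_0)\hat{\boldsymbol r}-\mathcal M\boldsymbol H_0-\hat{\boldsymbol r}\times(\mathcal A\boldsymbol H_0+\mathcal B\boldsymbol E_0)\big)-\frac{k^2}{r}\big(\hat{\boldsymbol r}\times(\hat{\boldsymbol r}\times\mathcal M\boldsymbol H_0)-\hat{\boldsymbol r}\times(\mathcal A\boldsymbol H_0+\mathcal B\boldsymbol E_0)\big)\Big\}+\boldsymbol R',$$ where $(\boldsymbol R')_j=(\boldsymbol R)_j+(\boldsymbol D_x^2G_k)_{\ell m}\varepsilon_{j\ell s}R_{msi}(\boldsymbol H_0)_i$. -/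

import Mathlib

open MeasureTheory Filter Topology
open scoped Matrix ContDiff

noncomputable section

namespace SmallObject

/-- Points of three-dimensional Euclidean space. -/
abbrev Pt := EuclideanSpace ℝ (Fin 3)

/-- Vectors with complex components. The product `a ⬝ᵥ b` is the bilinear one, without conjugation,
and `a ⨯₃ b` is the vector product. -/
abbrev CVec := Fin 3 → ℂ

/-- Complex vector fields. -/
abbrev VField := Pt → CVec

/-- The `i`-th unit vector. -/
def e (i : Fin 3) : CVec := Pi.single i 1

/-- A point of space, read as a vector with complex components. -/
def vec (x : Pt) : CVec := fun j => ((x j : ℝ) : ℂ)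

/-- The Levi-Civita symbol, as the triple product of unit vectors. -/
def levi (i j l : Fin 3) : ℂ := e i ⬝ᵥ (e j ⨯₃ e l)

/-- The classical partial derivative in the `j`-th coordinate. -/
def pd (j : Fin 3) (f : Pt → ℂ) (x : Pt) : ℂ := fderiv ℝ f x (EuclideanSpace.single j 1)

/-- The classical gradient. -/
def grad (f : Pt → ℂ) : VField := fun x j => pd j f x

/-- The classical curl. -/
def curl (F : VField) : VField := fun x =>
  ![pd 1 (fun y => F y 2) x - pd 2 (fun y => F y 1) x,
    pd 2 (fun y => F y 0) x - pd 0 (fun y => F y 2) x,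
    pd 0 (fun y => F y 1) x - pd 1 (fun y => F y 0) x]

/-- `F` is square integrable on every bounded part of `U`, up to the boundary of `U`. -/
def LocL2 (U : Set Pt) (F : VField) : Prop :=
  ∀ R : ℝ, MemLp F 2 (volume.restrict (U ∩ Metric.ball 0 R))

/-- On the open set `U`, the field `F` is in `H(curl)` (on bounded parts of `U`) and its weak
curl is `C`. -/
structure HasWeakCurl (U : Set Pt) (F C : VField) : Prop where
  field_L2 : LocL2 U F
  curl_L2 : LocL2 U C
  test : ∀ φ : VField, ContDiff ℝ ∞ φ → HasCompactSupport φ → tsupport φ ⊆ U →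
    ∫ x in U, F x ⬝ᵥ curl φ x = ∫ x in U, C x ⬝ᵥ φ x

/-- On the open set `U`, the weak divergence of `F` vanishes. -/
def WeakDivFree (U : Set Pt) (F : VField) : Prop :=
  ∀ φ : Pt → ℂ, ContDiff ℝ ∞ φ → HasCompactSupport φ → tsupport φ ⊆ U →
    ∫ x in U, F x ⬝ᵥ grad φ x = 0

/-- The exterior `ℝ³ \ closure B`. -/
def ext (B : Set Pt) : Set Pt := (closure B)ᶜ

/-- The tangential trace from inside, paired with a field `v` of curl `Cv`: this is
`∫_Γ (n × F)|₋ · v`, where `n` is the outward normal of `B`, in the sense of Green's formula for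
a field `F` of curl `C` in `B`. -/
def traceIn (B : Set Pt) (F C v Cv : VField) : ℂ :=
  ∫ x in B, (C x ⬝ᵥ v x - F x ⬝ᵥ Cv x)

/-- The tangential trace from outside, `∫_Γ (n × F)|₊ · v`, with the same normal `n`, in the sense
of Green's formula in the exterior, for a boundedly supported field `v`. -/
def traceOut (B : Set Pt) (F C v Cv : VField) : ℂ :=
  -∫ x in ext B, (C x ⬝ᵥ v x - F x ⬝ᵥ Cv x)

/-- The jump condition `[n × F]_Γ = n × g` for a constant vector `g`, in the sense of traces of
`H(curl)`; `C` is the curl of `F` in `B` and in the exterior of `B`. -/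
def TangentialJump (B : Set Pt) (F C : VField) (g : CVec) : Prop :=
  ∀ v Cv : VField, HasWeakCurl Set.univ v Cv → HasCompactSupport v →
    traceOut B F C v Cv - traceIn B F C v Cv = traceIn B (fun _ => g) (fun _ => 0) v Cv

open Classical in
/-- The coefficient that is `a` in `B` and `1` outside. -/
def coeff (B : Set Pt) (a : ℂ) (x : Pt) : ℂ := if x ∈ B then a else 1

/-- The Silver-Müller radiation condition with wave number `κ` for a field `u` with curl `c`,
uniformly in all directions; `u` and `c` are classes of fields up to null sets. -/
def Radiating (κ : ℝ) (u c : VField) : Prop :=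
  Tendsto (fun x : Pt => ((‖x‖ : ℝ) : ℂ) •
      (c x ⨯₃ vec (‖x‖⁻¹ • x) - (Complex.I * (κ : ℂ)) • u x))
    (cocompact Pt ⊓ ae volume) (𝓝 0)

/-- `u`, with curl `c`, solves the transmission problem with wave number `κ` for an object `B` of
relative permittivity `εr` and relative permeability `μr`, source `f` in `B` and tangential jump
data `n × g`:
`∇ × μr⁻¹ ∇ × u - κ² εr u = f` in `B`, `∇ × ∇ × u - κ² u = 0` outside, `∇ · u = 0`,
`[n × u] = 0` and `[n × μ⁻¹ ∇ × u] = n × g` on the boundary, and `u` is radiating. -/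
structure SolvesTransmission (B : Set Pt) (κ μr : ℝ) (εr : ℂ) (f : VField) (g : CVec)
    (u c : VField) : Prop where
  curl_in : HasWeakCurl B u c
  curl_out : HasWeakCurl (ext B) u c
  div_in : WeakDivFree B u
  div_out : WeakDivFree (ext B) u
  jump : TangentialJump B u c 0
  curlcurl : ∃ d : VField,
    HasWeakCurl B (fun x => coeff B (μr : ℂ)⁻¹ x • c x) d ∧
    HasWeakCurl (ext B) (fun x => coeff B (μr : ℂ)⁻¹ x • c x) d ∧
    (∀ᵐ x ∂volume.restrict B, d x - ((κ : ℂ) ^ 2 * εr) • u x = f x) ∧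
    (∀ᵐ x ∂volume.restrict (ext B), d x - ((κ : ℂ) ^ 2) • u x = 0) ∧
    TangentialJump B (fun x => coeff B (μr : ℂ)⁻¹ x • c x) d g
  radiation : Radiating κ u c

/-- The transmission problem for `θ_i`; `c` is the curl of `θ_i`. -/
def SolvesTheta (B : Set Pt) (k α μr : ℝ) (εr : ℂ) (i : Fin 3) (θ c : VField) : Prop :=
  SolvesTransmission B (k * α) μr εr
    (fun ξ => (-((k : ℂ) ^ 2 * (α : ℂ) ^ 2 * (1 - εr))) • (e i ⨯₃ vec ξ))
    ((-2 * (1 - (μr : ℂ)⁻¹)) • e i) θ c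

/-- The transmission problem for `φ_i`; `c` is the curl of `φ_i`. -/
def SolvesPhi (B : Set Pt) (k α μr : ℝ) (εr : ℂ) (i : Fin 3) (φ c : VField) : Prop :=
  SolvesTransmission B (k * α) μr εr
    (fun _ => (-((k : ℂ) ^ 2 * (α : ℂ) ^ 2 * (1 - εr))) • e i) 0 φ c

/-- The parameter `ν = α² k² (εr - 1)`. -/
def nu (k α : ℝ) (εr : ℂ) : ℂ := (α : ℂ) ^ 2 * (k : ℂ) ^ 2 * (εr - 1)

/-- The tensor `A`. -/
def tensorA (B : Set Pt) (k α : ℝ) (εr : ℂ) (θ : Fin 3 → VField) (r i : Fin 3) : ℂ :=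
  Complex.I * (k : ℂ) * (α : ℂ) ^ 4 * (εr - 1) / 2 *
    (e r ⬝ᵥ ∫ ξ in B, (e i ⨯₃ vec ξ + θ i ξ))

/-- The tensor `B`. -/
def tensorB (B : Set Pt) (α : ℝ) (εr : ℂ) (φ : Fin 3 → VField) (r i : Fin 3) : ℂ :=
  (α : ℂ) ^ 3 * (εr - 1) * (e r ⬝ᵥ ∫ ξ in B, (e i + φ i ξ))

/-- The rank 3 tensor `C`, with indices `m`, `s`, `i`. -/
def tensorC (B : Set Pt) (k α : ℝ) (εr : ℂ) (θ : Fin 3 → VField) (m s i : Fin 3) : ℂ :=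
  -((k : ℂ) ^ 2 * (α : ℂ) ^ 5 * (εr - 1) / 2) *
    (e s ⬝ᵥ ∫ ξ in B, vec ξ m • (e i ⨯₃ vec ξ + θ i ξ))

/-- The rank 2 tensor `Č`. -/
def tensorCCheck (B : Set Pt) (k α : ℝ) (εr : ℂ) (θ : Fin 3 → VField) (r i : Fin 3) : ℂ :=
  -(nu k α εr * (α : ℂ) ^ 3 / 4) *
    (e r ⬝ᵥ ∫ ξ in B, vec ξ ⨯₃ (θ i ξ + e i ⨯₃ vec ξ))

/-- The tensor `N`; `cθ i` is the curl of `θ_i`. -/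
def tensorN (B : Set Pt) (α μr : ℝ) (cθ : Fin 3 → VField) (r i : Fin 3) : ℂ :=
  (α : ℂ) ^ 3 * (1 - (μr : ℂ)⁻¹) * (e r ⬝ᵥ ∫ ξ in B, (e i + (1 / 2 : ℂ) • cθ i ξ))

/-- The tensor `M = N - Č`. -/
def tensorM (B : Set Pt) (k α μr : ℝ) (εr : ℂ) (θ cθ : Fin 3 → VField) (r i : Fin 3) : ℂ :=
  tensorN B α μr cθ r i - tensorCCheck B k α εr θ r i

/-- The part of `C` that `Č` leaves out: `C_msi - ε_msr Č_ri`. -/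
def tensorRest (B : Set Pt) (k α : ℝ) (εr : ℂ) (θ : Fin 3 → VField) (m s i : Fin 3) : ℂ :=
  tensorC B k α εr θ m s i - ∑ r, levi m s r * tensorCCheck B k α εr θ r i

/-- The free space Green's function `G_k(x, z)` of the Helmholtz equation. -/
def green (k : ℝ) (x z : Pt) : ℂ :=
  Complex.exp (Complex.I * (k : ℂ) * ((‖x - z‖ : ℝ) : ℂ)) / (4 * (Real.pi : ℂ) * ((‖x - z‖ : ℝ) : ℂ))

/-- The gradient `∇_x G_k(x, z)`. -/
def gradG (k : ℝ) (x z : Pt) : CVec := grad (fun y => green k y z) x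

/-- The entries of the Hessian matrix `D_x² G_k(x, z)`. -/
def hessG (k : ℝ) (x z : Pt) (l m : Fin 3) : ℂ := pd l (fun y => pd m (fun w => green k w z) y) x

/-- Application of a rank 2 tensor to a vector. -/
def app (T : Fin 3 → Fin 3 → ℂ) (h : CVec) : CVec := fun r => ∑ i, T r i * h i

/-- The expansion, without its residual, in terms of tensors `A`, `B`, `C` and `N`;
`H` and `E` are the values of the background fields at `z`. -/
def expansion (k : ℝ) (x z : Pt) (A Bt : Fin 3 → Fin 3 → ℂ) (C : Fin 3 → Fin 3 → Fin 3 → ℂ)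
    (N : Fin 3 → Fin 3 → ℂ) (H E : CVec) : CVec := fun j =>
  -(Complex.I * (k : ℂ)) *
      (∑ p, ∑ r, ∑ i, gradG k x z p * levi j p r * (A r i * H i + Bt r i * E i))
    + (∑ l, ∑ m, ∑ s, ∑ i, hessG k x z l m * levi j l s * C m s i * H i)
    + ∑ r, ∑ i, (hessG k x z j r + (k : ℂ) ^ 2 * (if j = r then 1 else 0) * green k x z)
        * N r i * H i

/-- The contribution `(D_x² G_k)_lm ε_jls R_msi H_i` of a rank 3 tensor. -/
def restTerm (k : ℝ) (x z : Pt) (Rt : Fin 3 → Fin 3 → Fin 3 → ℂ) (H : CVec) : CVec := fun j =>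
  ∑ l, ∑ m, ∑ s, ∑ i, hessG k x z l m * levi j l s * Rt m s i * H i

/-- The alternative dipole form of the expansion, without its residual, in terms of tensors `A`,
`B` and `M`; here `r = |x - z|` and `rh` is the unit vector from `z` to `x`. -/
def dipoleForm (k : ℝ) (x z : Pt) (A Bt M : Fin 3 → Fin 3 → ℂ) (H E : CVec) : CVec :=
  let r : ℂ := ((‖x - z‖ : ℝ) : ℂ)
  let rh : CVec := vec (‖x - z‖⁻¹ • (x - z))
  let MH : CVec := app M H
  let AB : CVec := app A H + app Bt E
  (Complex.exp (Complex.I * (k : ℂ) * r) / (4 * (Real.pi : ℂ))) •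
    ((1 / r ^ 3) • ((3 * (rh ⬝ᵥ MH)) • rh - MH)
      - (Complex.I * (k : ℂ) / r ^ 2) • ((3 * (rh ⬝ᵥ MH)) • rh - MH - rh ⨯₃ AB)
      - ((k : ℂ) ^ 2 / r) • (rh ⨯₃ (rh ⨯₃ MH) - rh ⨯₃ AB))

end SmallObject

end

noncomputable section

namespace SmallObject

/-! ### Derivatives of the Green's function -/

/-! Symmetry of `tensorM` is a reciprocity statement. Up to a part that is visibly symmetric, the
entry `r i` is a constant times the source functional of the `r`-th problem evaluated on `θ i`, so
it suffices that sources and solutions of two transmission problems can be exchanged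
(`SolvesTransmission.reciprocity`). The bilinear energy form, taken without conjugation, is
symmetric; each solution is tested against the other one times a radial cutoff at radius `R`, and
only the shell terms `∫ c · (∇χ × w)` could spoil the exchange. By the radiation condition such a
term equals an expression symmetric in the two fields plus a remainder. The remainder is small
because the weighted `L²` mass of a solution in the shell stays bounded
(`SolvesTransmission.exists_shellEnergy_le`), which follows from testing with the conjugate field
and taking imaginary parts. Neither uniqueness of solutions nor their decay or regularity is needed.

The equivalence of the two expansions is algebra with the explicit derivatives of the Green's
function (`gradG_apply`, `hessG_apply`). Contracting the two Levi-Civita symbols turns the `Č` part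
of the rank 3 tensor into `tr(D²G) Č - D²G Č`, and `ΔG = -k² G` makes this `-(D²G + k² G) Č`. It
therefore merges with the term of `N` into one term with `M = N - Č`; `dipole_identity` then
collects powers of `1/r`. -/

/-- The norm is differentiated as the square root of the smooth squared norm. A derivative `L` is
exposed, not just partial derivatives, because the Hessian needs a product rule on top. -/
theorem hasFDerivAt_comp_norm_sub {f : ℝ → ℂ} {f' : ℂ} {y z : Pt} (hyz : y ≠ z)
    (hf : HasDerivAt f f' ‖y - z‖) :
    ∃ L : Pt →L[ℝ] ℂ, HasFDerivAt (fun w : Pt => f ‖w - z‖) L y ∧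
      ∀ m, L (EuclideanSpace.single m 1) = f' * (((y m - z m) / ‖y - z‖ : ℝ) : ℂ) := by
  have hne : y - z ≠ 0 := sub_ne_zero.mpr hyz
  have hn : ‖y - z‖ ≠ 0 := norm_ne_zero_iff.mpr hne
  have h1 : HasFDerivAt (fun w : Pt => ‖w - z‖ ^ 2) (2 • innerSL ℝ (y - z)) y := by
    exact (((hasStrictFDerivAt_norm_sq (y - z)).hasFDerivAt).comp y
      ((hasFDerivAt_id y).sub_const z)).congr_fderiv (ContinuousLinearMap.comp_id _)
  have h2 := h1.sqrt (by positivity)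
  have h3 : HasFDerivAt (fun w : Pt => ‖w - z‖)
      ((1 / (2 * √(‖y - z‖ ^ 2))) • (2 • innerSL ℝ (y - z))) y := by
    refine h2.congr_of_eventuallyEq (Eventually.of_forall fun w => ?_)
    simp
  refine ⟨_, hf.hasFDerivAt.comp y h3, fun m => ?_⟩
  simp [EuclideanSpace.inner_single_right]
  field_simp

theorem pd_comp_norm_sub {f : ℝ → ℂ} {f' : ℂ} {y z : Pt} (hyz : y ≠ z)
    (hf : HasDerivAt f f' ‖y - z‖) (m : Fin 3) :
    pd m (fun w : Pt => f ‖w - z‖) y = f' * (((y m - z m) / ‖y - z‖ : ℝ) : ℂ) := by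
  obtain ⟨L, hL, h⟩ := hasFDerivAt_comp_norm_sub hyz hf
  rw [pd, hL.fderiv, h]

/-- The radial profile of the Green's function. -/
def greenProfile (k r : ℝ) : ℂ :=
  Complex.exp (Complex.I * (k : ℂ) * (r : ℂ)) / (4 * (Real.pi : ℂ) * (r : ℂ))

theorem hasDerivAt_greenProfile (k : ℝ) {r : ℝ} (hr : r ≠ 0) :
    HasDerivAt (greenProfile k) ((Complex.I * k - 1 / r) * greenProfile k r) r := by
  have hr' : (r : ℂ) ≠ 0 := by exact_mod_cast hr
  have hpi : (Real.pi : ℂ) ≠ 0 := by exact_mod_cast Real.pi_ne_zero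
  have h0 : HasDerivAt (fun t : ℝ => (t : ℂ)) 1 r := Complex.ofRealCLM.hasDerivAt
  have h1 := ((h0.const_mul (Complex.I * (k : ℂ))).cexp).div
    (h0.const_mul (4 * (Real.pi : ℂ))) (by simp [hr, Real.pi_ne_zero])
  refine h1.congr_deriv ?_
  simp only [greenProfile]
  field_simp

theorem gradG_apply (k : ℝ) {x z : Pt} (hxz : x ≠ z) (p : Fin 3) :
    gradG k x z p = (Complex.I * k - 1 / ((‖x - z‖ : ℝ) : ℂ)) * green k x z
      * (((x p - z p) / ‖x - z‖ : ℝ) : ℂ) :=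
  pd_comp_norm_sub hxz
    (hasDerivAt_greenProfile k (norm_ne_zero_iff.mpr (sub_ne_zero.mpr hxz))) p

theorem hessG_apply (k : ℝ) {x z : Pt} (hxz : x ≠ z) (l m : Fin 3) :
    hessG k x z l m = green k x z *
      ((3 / ((‖x - z‖ : ℝ) : ℂ) ^ 2 - 3 * Complex.I * k / ((‖x - z‖ : ℝ) : ℂ) - (k : ℂ) ^ 2)
          * (((x l - z l) / ‖x - z‖ : ℝ) : ℂ) * (((x m - z m) / ‖x - z‖ : ℝ) : ℂ)
        + (Complex.I * k / ((‖x - z‖ : ℝ) : ℂ) - 1 / ((‖x - z‖ : ℝ) : ℂ) ^ 2)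
          * (if l = m then 1 else 0)) := by
  have hn : ‖x - z‖ ≠ 0 := norm_ne_zero_iff.mpr (sub_ne_zero.mpr hxz)
  have hnc : ((‖x - z‖ : ℝ) : ℂ) ≠ 0 := by exact_mod_cast hn
  -- Near `x`, a gradient component is a radial factor times the linear function `y m - z m`, so the
  -- radial derivative lemma applies a second time, together with the product rule.
  have hev : (fun y => pd m (fun w => green k w z) y) =ᶠ[𝓝 x] fun y =>
      ((Complex.I * k - 1 / ((‖y - z‖ : ℝ) : ℂ)) * greenProfile k ‖y - z‖ / ((‖y - z‖ : ℝ) : ℂ))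
        * ((y m - z m : ℝ) : ℂ) := by
    filter_upwards [isOpen_ne.mem_nhds hxz] with y hy
    have := gradG_apply k hy m
    simp only [gradG, grad] at this
    rw [this, green, greenProfile]
    push_cast
    ring
  have h0 : HasDerivAt (fun t : ℝ => (t : ℂ)) 1 ‖x - z‖ := Complex.ofRealCLM.hasDerivAt
  have h1 := ((((hasDerivAt_const _ (1 : ℂ)).div h0 hnc).const_sub (Complex.I * k)).mul
    (hasDerivAt_greenProfile k hn)).div h0 hnc
  obtain ⟨L, hL, hLm⟩ := hasFDerivAt_comp_norm_sub hxz h1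
  have h2 : HasFDerivAt (fun y : Pt => ((y m - z m : ℝ) : ℂ))
      (Complex.ofRealCLM.comp (EuclideanSpace.proj m : Pt →L[ℝ] ℝ)) x :=
    Complex.ofRealCLM.hasFDerivAt.comp x
      ((EuclideanSpace.proj m : Pt →L[ℝ] ℝ).hasFDerivAt.sub_const (z m))
  have h3 := hL.mul h2
  rw [hessG, pd, hev.fderiv_eq]
  have h4 := h3.fderiv
  simp only [Pi.div_apply, Pi.mul_apply] at h4
  refine (congrArg (fun T : Pt →L[ℝ] ℂ => T (EuclideanSpace.single l 1)) h4).trans ?_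
  simp only [add_apply, smul_apply, hLm, smul_eq_mul]
  have hs : (Complex.ofRealCLM.comp (EuclideanSpace.proj m : Pt →L[ℝ] ℝ))
      (EuclideanSpace.single l 1) = if l = m then 1 else 0 := by
    simp [eq_comm, apply_ite Complex.ofReal]
  rw [hs]
  have hg : green k x z = greenProfile k ‖x - z‖ := rfl
  rw [hg]
  push_cast
  simp only [Pi.div_apply, Pi.mul_apply]
  have hI : Complex.I ^ 2 = -1 := Complex.I_sq
  field_simp
  ring_nf
  simp only [hI]
  ring

/-! ### Levi-Civita contractions and the dipole form of the expansion -/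

theorem levi_eq (i j l : Fin 3) : levi i j l =
    if (i, j, l) = (0, 1, 2) ∨ (i, j, l) = (1, 2, 0) ∨ (i, j, l) = (2, 0, 1) then 1
    else if (i, j, l) = (0, 2, 1) ∨ (i, j, l) = (2, 1, 0) ∨ (i, j, l) = (1, 0, 2) then -1
    else 0 := by
  fin_cases i <;> fin_cases j <;> fin_cases l <;>
    simp [levi, e, cross_apply, dotProduct, Fin.sum_univ_three]

theorem dotProduct_hat_self {x z : Pt} (hxz : x ≠ z) :
    vec (‖x - z‖⁻¹ • (x - z)) ⬝ᵥ vec (‖x - z‖⁻¹ • (x - z)) = 1 := by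
  have hn : ‖x - z‖ ≠ 0 := norm_ne_zero_iff.mpr (sub_ne_zero.mpr hxz)
  have h := EuclideanSpace.real_norm_sq_eq (x - z)
  have h1 : ∑ j, (‖x - z‖⁻¹ * (x - z) j) * (‖x - z‖⁻¹ * (x - z) j) = 1 := by
    rw [Finset.sum_congr rfl fun j _ => show _ = (‖x - z‖⁻¹) ^ 2 * (x - z) j ^ 2 by ring,
      ← Finset.mul_sum, ← h]
    field_simp
  have h2 := congrArg Complex.ofReal h1
  push_cast at h2
  simpa [dotProduct, vec] using h2

/-- This is `ε_jls ε_msr = δ_lm δ_jr - δ_jm δ_lr` applied to `h_lm d_r`. -/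
theorem sum_levi_mul_levi (h : Fin 3 → Fin 3 → ℂ) (d : CVec) (j : Fin 3) :
    ∑ l, ∑ m, ∑ s, h l m * levi j l s * ∑ r, levi m s r * d r
      = (∑ l, h l l) * d j - ∑ l, h l j * d l := by
  fin_cases j <;> simp [Fin.sum_univ_three, levi_eq] <;> ring

theorem sum_mul_levi (g a : CVec) (j : Fin 3) :
    ∑ p, ∑ r, g p * levi j p r * a r = (g ⨯₃ a) j := by
  fin_cases j <;> simp [Fin.sum_univ_three, levi_eq, cross_apply] <;> ring

/-- Here `G` is the exponential over `4π`, so `G * (1 / ρ)` is the Green's function and `v` the unit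
direction; `a`, `n`, `d` stand for `A H + B E`, `N H` and `Č H`. After the trace is evaluated, `n`
and `d` enter only through `n - d`. -/
theorem dipole_identity (k G : ℂ) {ρ : ℂ} (hρ : ρ ≠ 0) {v : CVec} (hv : v ⬝ᵥ v = 1)
    (a n d : CVec) (j : Fin 3) :
    -(Complex.I * k) * ((fun p => (Complex.I * k - 1 / ρ) * (G * (1 / ρ)) * v p) ⨯₃ a) j
      + ((∑ l, G * (1 / ρ) * ((3 / ρ ^ 2 - 3 * Complex.I * k / ρ - k ^ 2) * v l * v l
            + (Complex.I * k / ρ - 1 / ρ ^ 2) * if l = l then 1 else 0)) * d j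
        - ∑ l, G * (1 / ρ) * ((3 / ρ ^ 2 - 3 * Complex.I * k / ρ - k ^ 2) * v l * v j
            + (Complex.I * k / ρ - 1 / ρ ^ 2) * if l = j then 1 else 0) * d l)
      + ∑ r, (G * (1 / ρ) * ((3 / ρ ^ 2 - 3 * Complex.I * k / ρ - k ^ 2) * v j * v r
            + (Complex.I * k / ρ - 1 / ρ ^ 2) * if j = r then 1 else 0)
          + (k ^ 2 * if j = r then 1 else 0) * (G * (1 / ρ))) * n r
      = (G • ((1 / ρ ^ 3) • ((3 * (v ⬝ᵥ (n - d))) • v - (n - d))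
        - (Complex.I * k / ρ ^ 2) • ((3 * (v ⬝ᵥ (n - d))) • v - (n - d) - v ⨯₃ a)
        - (k ^ 2 / ρ) • (v ⨯₃ (v ⨯₃ (n - d)) - v ⨯₃ a))) j := by
  -- The Helmholtz equation `ΔG = -k² G`, obtained from the explicit Hessian and `v · v = 1`.
  have htr : ∑ l, G * (1 / ρ) * ((3 / ρ ^ 2 - 3 * Complex.I * k / ρ - k ^ 2) * v l * v l
      + (Complex.I * k / ρ - 1 / ρ ^ 2) * if l = l then 1 else 0) = -k ^ 2 * (G * (1 / ρ)) := by
    simp only [dotProduct, Fin.sum_univ_three] at hv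
    simp only [Fin.sum_univ_three, if_true]
    linear_combination G * (1 / ρ) * (3 / ρ ^ 2 - 3 * Complex.I * k / ρ - k ^ 2) * hv
  have hcc : v ⨯₃ (v ⨯₃ (n - d)) = (v ⬝ᵥ (n - d)) • v - (n - d) := by
    rw [cross_cross_eq_smul_sub_smul', hv, one_smul, dotProduct_comm]
  have hca : (fun p => (Complex.I * k - 1 / ρ) * (G * (1 / ρ)) * v p) ⨯₃ a
      = ((Complex.I * k - 1 / ρ) * (G * (1 / ρ))) • (v ⨯₃ a) := by
    rw [← LinearMap.smul_apply, ← map_smul]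
    rfl
  have hdl : ∀ l, (if l = j then (1 : ℂ) else 0) = if j = l then 1 else 0 := fun l => by
    simp only [eq_comm]
  have h1 : ∑ l, G * (1 / ρ) * ((3 / ρ ^ 2 - 3 * Complex.I * k / ρ - k ^ 2) * v l * v j
      + (Complex.I * k / ρ - 1 / ρ ^ 2) * if l = j then 1 else 0) * d l
      = G * (1 / ρ) * ((3 / ρ ^ 2 - 3 * Complex.I * k / ρ - k ^ 2) * v j * (v ⬝ᵥ d)
        + (Complex.I * k / ρ - 1 / ρ ^ 2) * d j) := by
    have : d j = ∑ l, (if l = j then 1 else 0) * d l := by simp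
    rw [this, dotProduct]
    simp only [Finset.mul_sum, ← Finset.sum_add_distrib]
    exact Finset.sum_congr rfl fun l _ => by ring
  have h2 : ∑ r, (G * (1 / ρ) * ((3 / ρ ^ 2 - 3 * Complex.I * k / ρ - k ^ 2) * v j * v r
      + (Complex.I * k / ρ - 1 / ρ ^ 2) * if j = r then 1 else 0)
      + (k ^ 2 * if j = r then 1 else 0) * (G * (1 / ρ))) * n r
      = G * (1 / ρ) * ((3 / ρ ^ 2 - 3 * Complex.I * k / ρ - k ^ 2) * v j * (v ⬝ᵥ n)
        + (Complex.I * k / ρ - 1 / ρ ^ 2 + k ^ 2) * n j) := by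
    have : n j = ∑ l, (if j = l then 1 else 0) * n l := by simp
    rw [this, dotProduct]
    simp only [Finset.mul_sum, ← Finset.sum_add_distrib]
    exact Finset.sum_congr rfl fun l _ => by ring
  rw [htr, hcc, hca, h1, h2]
  simp only [Pi.smul_apply, Pi.sub_apply, smul_eq_mul, dotProduct_sub]
  have hI : Complex.I ^ 2 = -1 := Complex.I_sq
  field_simp
  ring_nf
  simp only [hI]
  ring

theorem expansion_eq_dipoleForm_add_restTerm (B : Set Pt) (k α μr : ℝ) (εr : ℂ)
    (θ cθ φ : Fin 3 → VField) {x z : Pt} (hxz : x ≠ z) (H E : CVec) :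
    expansion k x z (tensorA B k α εr θ) (tensorB B α εr φ) (tensorC B k α εr θ)
        (tensorN B α μr cθ) H E
      = dipoleForm k x z (tensorA B k α εr θ) (tensorB B α εr φ) (tensorM B k α μr εr θ cθ) H E
        + restTerm k x z (tensorRest B k α εr θ) H := by
  have hn : ‖x - z‖ ≠ 0 := norm_ne_zero_iff.mpr (sub_ne_zero.mpr hxz)
  have hnc : ((‖x - z‖ : ℝ) : ℂ) ≠ 0 := by exact_mod_cast hn
  have hhat := dotProduct_hat_self hxz
  have hr : ∀ j, (((x j - z j) / ‖x - z‖ : ℝ) : ℂ) = vec (‖x - z‖⁻¹ • (x - z)) j := fun j => by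
    simp [vec, div_eq_inv_mul]
  have hG : green k x z = Complex.exp (Complex.I * (k : ℂ) * ((‖x - z‖ : ℝ) : ℂ))
      / (4 * (Real.pi : ℂ)) * (1 / ((‖x - z‖ : ℝ) : ℂ)) := by
    rw [green, mul_one_div, div_div]
  unfold expansion dipoleForm restTerm tensorRest tensorM app
  simp only [gradG_apply k hxz, hessG_apply k hxz, hr, hG]
  -- From here only `ρ ≠ 0` and `v · v = 1` matter; the identity holds for arbitrary tensors in
  -- place of those built from the solutions.
  generalize vec (‖x - z‖⁻¹ • (x - z)) = v at *
  generalize ((‖x - z‖ : ℝ) : ℂ) = ρ at *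
  generalize Complex.exp (Complex.I * (k : ℂ) * ρ) / (4 * (Real.pi : ℂ)) = G
  generalize tensorA B k α εr θ = A
  generalize tensorB B α εr φ = T
  generalize tensorC B k α εr θ = C
  generalize tensorN B α μr cθ = N
  generalize tensorCCheck B k α εr θ = D
  funext j
  have hA : ∀ g : CVec, ∑ p, ∑ r, ∑ i, g p * levi j p r * (A r i * H i + T r i * E i)
      = (g ⨯₃ ((fun r => ∑ i, A r i * H i) + fun r => ∑ i, T r i * E i)) j := fun g => by
    rw [← sum_mul_levi]
    simp only [← Finset.mul_sum, Finset.sum_add_distrib, Pi.add_apply]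
  -- Adding and subtracting `ε_msr Č_ri` splits off the residual tensor; the contraction identity
  -- evaluates what remains.
  have hC : ∀ h : Fin 3 → Fin 3 → ℂ, ∑ l, ∑ m, ∑ s, ∑ i, h l m * levi j l s * C m s i * H i
      = (∑ l, ∑ m, ∑ s, ∑ i, h l m * levi j l s * (C m s i - ∑ r, levi m s r * D r i) * H i)
        + ((∑ l, h l l) * (∑ i, D j i * H i) - ∑ l, h l j * ∑ i, D l i * H i) := fun h => by
    rw [← sum_levi_mul_levi h (fun r => ∑ i, D r i * H i) j]
    simp only [← Finset.sum_add_distrib]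
    refine Finset.sum_congr rfl fun l _ => Finset.sum_congr rfl fun m _ =>
      Finset.sum_congr rfl fun s _ => ?_
    have : ∑ r, levi m s r * ∑ i, D r i * H i = ∑ i, (∑ r, levi m s r * D r i) * H i := by
      simp only [Finset.mul_sum, Finset.sum_mul]
      rw [Finset.sum_comm]
      simp only [mul_assoc]
    rw [this, Finset.mul_sum, ← Finset.sum_add_distrib]
    exact Finset.sum_congr rfl fun i _ => by ring
  have hN : ∀ q : CVec, ∑ r, ∑ i, q r * N r i * H i = ∑ r, q r * ∑ i, N r i * H i := fun q => by
    simp only [Finset.mul_sum, mul_assoc]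
  have hM : (fun r => ∑ i, (N r i - D r i) * H i)
      = (fun r => ∑ i, N r i * H i) - fun r => ∑ i, D r i * H i := by
    funext r
    simp [sub_mul]
  rw [hA, hC, hN, hM]
  have key := dipole_identity (k : ℂ) G hnc hhat
    ((fun r => ∑ i, A r i * H i) + (fun r => ∑ i, T r i * E i))
    (fun r => ∑ i, N r i * H i) (fun r => ∑ i, D r i * H i) j
  rw [Pi.add_apply, ← key]
  ring

/-! ### Classical differential operators -/

theorem contDiff_apply_comp {φ : VField} {n : WithTop ℕ∞} (h : ContDiff ℝ n φ) (j : Fin 3) :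
    ContDiff ℝ n fun x => φ x j :=
  contDiff_pi.mp h j

theorem contDiff_pd {f : Pt → ℂ} (h : ContDiff ℝ ∞ f) (j : Fin 3) : ContDiff ℝ ∞ (pd j f) :=
  (h.fderiv_right (by simp)).clm_apply contDiff_const

theorem contDiff_grad {f : Pt → ℂ} (h : ContDiff ℝ ∞ f) : ContDiff ℝ ∞ (grad f) :=
  contDiff_pi.mpr fun j => contDiff_pd h j

theorem contDiff_curl {φ : VField} (h : ContDiff ℝ ∞ φ) : ContDiff ℝ ∞ (curl φ) := by
  have hp := fun i j => contDiff_pd (contDiff_apply_comp h j) i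
  refine contDiff_pi.mpr fun j => ?_
  fin_cases j
  · exact (hp 1 2).sub (hp 2 1)
  · exact (hp 2 0).sub (hp 0 2)
  · exact (hp 0 1).sub (hp 1 0)

theorem hasCompactSupport_apply {φ : VField} (h : HasCompactSupport φ) (j : Fin 3) :
    HasCompactSupport fun x => φ x j :=
  h.comp_left (g := fun v : CVec => v j) rfl

theorem hasCompactSupport_pd {f : Pt → ℂ} (h : HasCompactSupport f) (j : Fin 3) :
    HasCompactSupport (pd j f) :=
  (h.fderiv (𝕜 := ℝ)).comp_left (g := fun L : Pt →L[ℝ] ℂ => L (EuclideanSpace.single j 1)) rfl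

theorem tsupport_pd_apply_subset (φ : VField) (i j : Fin 3) :
    tsupport (pd i fun y => φ y j) ⊆ tsupport φ :=
  (tsupport_comp_subset (g := fun L : Pt →L[ℝ] ℂ => L (EuclideanSpace.single i 1)) rfl
      (fderiv ℝ fun y => φ y j)).trans
    ((tsupport_fderiv_subset ℝ).trans
      (tsupport_comp_subset (g := fun v : CVec => v j) rfl φ))

theorem curl_eq_zero_of_notMem_tsupport {φ : VField} {x : Pt} (hx : x ∉ tsupport φ) :
    curl φ x = 0 := by
  have h : ∀ i j, pd i (fun y => φ y j) x = 0 := fun i j =>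
    image_eq_zero_of_notMem_tsupport fun hm => hx (tsupport_pd_apply_subset φ i j hm)
  simp only [curl, h, sub_zero]
  funext j
  fin_cases j <;> rfl

theorem hasCompactSupport_curl {φ : VField} (h : HasCompactSupport φ) :
    HasCompactSupport (curl φ) :=
  HasCompactSupport.intro h fun _ hx => curl_eq_zero_of_notMem_tsupport hx

theorem pd_mul {f g : Pt → ℂ} {x : Pt} (hf : DifferentiableAt ℝ f x) (hg : DifferentiableAt ℝ g x)
    (j : Fin 3) : pd j (fun y => f y * g y) x = f x * pd j g x + g x * pd j f x := by
  rw [pd, fderiv_fun_mul hf hg]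
  simp [pd]

theorem pd_star (f : Pt → ℂ) (x : Pt) (j : Fin 3) :
    pd j (fun y => star (f y)) x = star (pd j f x) := by
  have h := Complex.conjCLE.comp_fderiv (f := f) (x := x)
  exact congrArg (fun L : Pt →L[ℝ] ℂ => L (EuclideanSpace.single j 1)) h

theorem curl_smul {χ : Pt → ℂ} {φ : VField} (hχ : ContDiff ℝ ∞ χ) (hφ : ContDiff ℝ ∞ φ) (x : Pt) :
    curl (fun y => χ y • φ y) x = χ x • curl φ x + grad χ x ⨯₃ φ x := by
  have hd : ∀ j, DifferentiableAt ℝ (fun y => φ y j) x := fun j =>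
    (contDiff_apply_comp hφ j).contDiffAt.differentiableAt (by simp)
  have hχd : DifferentiableAt ℝ χ x := hχ.contDiffAt.differentiableAt (by simp)
  have h : ∀ i j, pd i (fun y => χ y * φ y j) x
      = χ x * pd i (fun y => φ y j) x + φ x j * pd i χ x := fun i j => pd_mul hχd (hd j) i
  funext j
  fin_cases j <;> simp [curl, cross_apply, grad, h] <;> ring

theorem curl_star (φ : VField) (x : Pt) :
    curl (fun y => star (φ y)) x = star (curl φ x) := by
  have h : ∀ i j, pd i (fun y => star (φ y) j) x = star (pd i (fun y => φ y j) x) := fun i j =>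
    pd_star _ x i
  funext j
  fin_cases j <;> simp [curl] <;> simp only [← Complex.star_def, ← h] <;> rfl

theorem integral_mul_pd {f g : Pt → ℂ} (hf : ContDiff ℝ ∞ f) (hg : ContDiff ℝ ∞ g)
    (hgc : HasCompactSupport g) (j : Fin 3) :
    ∫ x, f x * pd j g x = -∫ x, pd j f x * g x := by
  refine integral_mul_fderiv_eq_neg_fderiv_mul_of_integrable ?_ ?_ ?_
    (fun x _ => hf.contDiffAt.differentiableAt (by simp))
    (fun x _ => hg.contDiffAt.differentiableAt (by simp))
  · exact ((contDiff_pd hf j).continuous.mul hg.continuous).integrable_of_hasCompactSupport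
      hgc.mul_left
  · exact (hf.continuous.mul (contDiff_pd hg j).continuous).integrable_of_hasCompactSupport
      (hasCompactSupport_pd hgc j).mul_left
  · exact (hf.continuous.mul hg.continuous).integrable_of_hasCompactSupport hgc.mul_left

theorem integral_sub_add_sub_add_sub {a b c d f g : Pt → ℂ} (ha : Integrable a)
    (hb : Integrable b) (hc : Integrable c) (hd : Integrable d) (hf : Integrable f)
    (hg : Integrable g) : ∫ x, ((a x - b x) + (c x - d x) + (f x - g x))
      = ((∫ x, a x) - ∫ x, b x) + ((∫ x, c x) - ∫ x, d x) + ((∫ x, f x) - ∫ x, g x) := by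
  rw [← integral_sub ha hb, ← integral_sub hc hd, ← integral_sub hf hg]
  exact (integral_add ((ha.sub hb).add (hc.sub hd)) (hf.sub hg)).trans
    (congrArg (· + _) (integral_add (ha.sub hb) (hc.sub hd)))

/-- The minus sign from integration by parts cancels the one from the antisymmetry of the curl, so
the curl is symmetric for the bilinear pairing. -/
theorem integral_dotProduct_curl {φ ψ : VField} (hφ : ContDiff ℝ ∞ φ) (hψ : ContDiff ℝ ∞ ψ)
    (hψc : HasCompactSupport ψ) :
    ∫ x, φ x ⬝ᵥ curl ψ x = ∫ x, curl φ x ⬝ᵥ ψ x := by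
  have hf := contDiff_apply_comp hφ
  have hg := contDiff_apply_comp hψ
  have hgc := hasCompactSupport_apply hψc
  have i1 : ∀ a b c, Integrable fun x => φ x a * pd b (fun y => ψ y c) x := fun a b c =>
    ((hf a).continuous.mul (contDiff_pd (hg c) b).continuous).integrable_of_hasCompactSupport
      (hasCompactSupport_pd (hgc c) b).mul_left
  have i2 : ∀ a b c, Integrable fun x => pd b (fun y => φ y a) x * ψ x c := fun a b c =>
    ((contDiff_pd (hf a) b).continuous.mul (hg c).continuous).integrable_of_hasCompactSupport
      (hgc c).mul_left
  have h : ∀ a b c, ∫ x, φ x a * pd b (fun y => ψ y c) x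
      = -∫ x, pd b (fun y => φ y a) x * ψ x c := fun a b c => integral_mul_pd (hf a) (hg c) (hgc c) b
  have e1 : ∫ x, φ x ⬝ᵥ curl ψ x
      = (((∫ x, φ x 0 * pd 1 (fun y => ψ y 2) x) - ∫ x, φ x 0 * pd 2 (fun y => ψ y 1) x)
        + ((∫ x, φ x 1 * pd 2 (fun y => ψ y 0) x) - ∫ x, φ x 1 * pd 0 (fun y => ψ y 2) x))
        + ((∫ x, φ x 2 * pd 0 (fun y => ψ y 1) x) - ∫ x, φ x 2 * pd 1 (fun y => ψ y 0) x) := by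
    rw [← integral_sub_add_sub_add_sub (i1 _ _ _) (i1 _ _ _) (i1 _ _ _) (i1 _ _ _) (i1 _ _ _) (i1 _ _ _)]
    congr 1
    funext x
    simp [dotProduct, Fin.sum_univ_three, curl, mul_sub]
  have e2 : ∫ x, curl φ x ⬝ᵥ ψ x
      = (((∫ x, pd 1 (fun y => φ y 2) x * ψ x 0) - ∫ x, pd 2 (fun y => φ y 1) x * ψ x 0)
        + ((∫ x, pd 2 (fun y => φ y 0) x * ψ x 1) - ∫ x, pd 0 (fun y => φ y 2) x * ψ x 1))
        + ((∫ x, pd 0 (fun y => φ y 1) x * ψ x 2) - ∫ x, pd 1 (fun y => φ y 0) x * ψ x 2) := by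
    rw [← integral_sub_add_sub_add_sub (i2 _ _ _) (i2 _ _ _) (i2 _ _ _) (i2 _ _ _) (i2 _ _ _) (i2 _ _ _)]
    congr 1
    funext x
    simp [dotProduct, Fin.sum_univ_three, curl, sub_mul]
  rw [e1, e2]
  simp only [h]
  ring

/-! ### Locally square integrable fields -/

theorem LocL2.mono {U V : Set Pt} {F : VField} (h : LocL2 V F) (hUV : U ⊆ V) : LocL2 U F :=
  fun R => (h R).mono_measure (Measure.restrict_mono (Set.inter_subset_inter_left _ hUV) le_rfl)

theorem LocL2.conj {U : Set Pt} {F : VField} (h : LocL2 U F) : LocL2 U fun x => star (F x) :=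
  fun R => (h R).star

theorem continuous_cross : Continuous fun p : CVec × CVec => p.1 ⨯₃ p.2 := by
  refine continuous_pi fun j => ?_
  fin_cases j <;> simp only [cross_apply] <;> simp <;> fun_prop

theorem norm_cross_le (a b : CVec) : ‖a ⨯₃ b‖ ≤ 2 * (‖a‖ * ‖b‖) := by
  have hs : ∀ i j k l, ‖a i * b j - a k * b l‖ ≤ 2 * (‖a‖ * ‖b‖) := fun i j k l => by
    have hm : ∀ i j, ‖a i * b j‖ ≤ ‖a‖ * ‖b‖ := fun i j => by
      rw [norm_mul]
      exact mul_le_mul (norm_le_pi_norm a i) (norm_le_pi_norm b j) (norm_nonneg _) (norm_nonneg _)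
    linarith [norm_sub_le (a i * b j) (a k * b l), hm i j, hm k l]
  refine (pi_norm_le_iff_of_nonneg (by positivity)).mpr fun j => ?_
  rw [cross_apply]
  fin_cases j <;> exact hs _ _ _ _

theorem exists_norm_le_on_ball {E : Type*} [NormedAddCommGroup E] {f : Pt → E}
    (hf : Continuous f) (R : ℝ) : ∃ C, ∀ x ∈ Metric.ball (0 : Pt) R, ‖f x‖ ≤ C := by
  obtain ⟨C, hC⟩ := (isCompact_closedBall (0 : Pt) R).exists_bound_of_continuousOn hf.continuousOn
  exact ⟨C, fun x hx => hC x (Metric.ball_subset_closedBall hx)⟩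

/-- A continuous factor is bounded on each ball, which is all that a local condition sees. -/
theorem LocL2.of_norm_le_mul {U : Set Pt} (hU : MeasurableSet U) {F G : VField} (hG : LocL2 U G)
    {f : Pt → ℝ} (hf : Continuous f)
    (hF : ∀ R, AEStronglyMeasurable F (volume.restrict (U ∩ Metric.ball 0 R)))
    (h : ∀ x, ‖F x‖ ≤ f x * ‖G x‖) : LocL2 U F := fun R => by
  obtain ⟨C, hC⟩ := exists_norm_le_on_ball hf R
  refine (hG R).of_le_mul (c := C) (hF R) ?_
  filter_upwards [ae_restrict_mem (hU.inter measurableSet_ball)] with x hx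
  refine (h x).trans (mul_le_mul_of_nonneg_right ?_ (norm_nonneg _))
  exact (le_abs_self _).trans (hC x hx.2)

theorem LocL2.smul {U : Set Pt} (hU : MeasurableSet U) {F : VField} (h : LocL2 U F) {χ : Pt → ℂ}
    (hχ : Continuous χ) : LocL2 U fun x => χ x • F x :=
  h.of_norm_le_mul hU hχ.norm (fun R => hχ.aestronglyMeasurable.smul (h R).1)
    fun _ => (norm_smul _ _).le

theorem LocL2.cross_left {U : Set Pt} (hU : MeasurableSet U) {F : VField} (h : LocL2 U F)
    {g : VField} (hg : Continuous g) : LocL2 U fun x => g x ⨯₃ F x := by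
  have hm : ∀ R, AEStronglyMeasurable (fun x => g x ⨯₃ F x)
      (volume.restrict (U ∩ Metric.ball 0 R)) := fun R =>
    continuous_cross.comp_aestronglyMeasurable (g := fun p : CVec × CVec => p.1 ⨯₃ p.2)
      (f := fun x => (g x, F x)) (hg.aestronglyMeasurable.prodMk (h R).1)
  have hf : Continuous fun x => 2 * ‖g x‖ := hg.norm.const_mul 2
  exact h.of_norm_le_mul hU hf hm fun x => (norm_cross_le _ _).trans_eq (mul_assoc _ _ _).symm

theorem LocL2.add {U : Set Pt} {F G : VField} (hF : LocL2 U F) (hG : LocL2 U G) :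
    LocL2 U fun x => F x + G x := fun R => (hF R).add (hG R)

theorem LocL2.of_continuous {U : Set Pt} (hU : MeasurableSet U) {F : VField} (hF : Continuous F) :
    LocL2 U F := fun R => by
  obtain ⟨C, hC⟩ := exists_norm_le_on_ball hF R
  have : IsFiniteMeasure (volume.restrict (U ∩ Metric.ball (0 : Pt) R)) :=
    ⟨by
      rw [Measure.restrict_apply_univ]
      exact (measure_mono Set.inter_subset_right).trans_lt measure_ball_lt_top⟩
  refine MemLp.of_bound hF.aestronglyMeasurable C ?_
  filter_upwards [ae_restrict_mem (hU.inter measurableSet_ball)] with x hx using hC x hx.2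

theorem LocL2.integrableOn_dotProduct {U : Set Pt} {F G : VField} (hF : LocL2 U F)
    (hG : LocL2 U G) (R : ℝ) :
    IntegrableOn (fun x => F x ⬝ᵥ G x) (U ∩ Metric.ball 0 R) := by
  simp only [dotProduct]
  exact integrable_finsetSum _ fun j _ => ((hF R).eval j).integrable_mul ((hG R).eval j)

/-- The field vanishes outside a bounded set. -/
def BoundedSupport (G : VField) : Prop := ∃ R : ℝ, ∀ x, R ≤ ‖x‖ → G x = 0

theorem LocL2.integrableOn_dotProduct_of_boundedSupport {U : Set Pt} (hU : MeasurableSet U)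
    {F G : VField} (hF : LocL2 U F) (hG : LocL2 U G) (hb : BoundedSupport G) :
    IntegrableOn (fun x => F x ⬝ᵥ G x) U := by
  obtain ⟨R, hR⟩ := hb
  refine (hF.integrableOn_dotProduct hG R).of_forall_sdiff_eq_zero hU fun x hx => ?_
  have : R ≤ ‖x‖ := by
    by_contra hlt
    exact hx.2 ⟨hx.1, by simpa using hlt⟩
  rw [hR x this, dotProduct_zero]

theorem BoundedSupport.of_hasCompactSupport {G : VField} (h : HasCompactSupport G) :
    BoundedSupport G := by
  obtain ⟨R, hR⟩ := h.isBounded.subset_ball (0 : Pt)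
  refine ⟨R, fun x hx => image_eq_zero_of_notMem_tsupport fun hm => ?_⟩
  have := hR hm
  rw [mem_ball_zero_iff] at this
  linarith

/-! ### Weak curl on the whole space -/

theorem hasWeakCurl_of_contDiff {φ : VField} (hφ : ContDiff ℝ ∞ φ) :
    HasWeakCurl Set.univ φ (curl φ) where
  field_L2 := LocL2.of_continuous .univ hφ.continuous
  curl_L2 := LocL2.of_continuous .univ (contDiff_curl hφ).continuous
  test ψ hψ hψc _ := by
    simpa using integral_dotProduct_curl hφ hψ hψc

/-- Conjugating the test field moves the conjugation onto `u`. This makes the conjugate of a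
solution an admissible test field, as the energy estimate requires while the pairing itself is
bilinear. -/
theorem HasWeakCurl.conj {u c : VField} (h : HasWeakCurl Set.univ u c) :
    HasWeakCurl Set.univ (fun x => star (u x)) (fun x => star (c x)) where
  field_L2 := h.field_L2.conj
  curl_L2 := h.curl_L2.conj
  test φ hφ hφc _ := by
    have hs : ContDiff ℝ ∞ fun x => star (φ x) := contDiff_pi.mpr fun j =>
      Complex.conjCLE.contDiff.comp (contDiff_apply_comp hφ j)
    have h1 := h.test _ hs (hφc.comp_left (g := fun v : CVec => star v) (star_zero _))
      (Set.subset_univ _)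
    have h2 := congrArg (starRingEnd ℂ) h1
    rw [← integral_conj, ← integral_conj] at h2
    have hd : ∀ a b : CVec, starRingEnd ℂ (a ⬝ᵥ star b) = star a ⬝ᵥ b := fun a b => by
      rw [starRingEnd_apply, ← Matrix.star_dotProduct_star, star_star, dotProduct_comm]
    simpa only [curl_star, hd] using h2

theorem dotProduct_cross_right_comm (a b c : CVec) : a ⬝ᵥ (b ⨯₃ c) = -((b ⨯₃ a) ⬝ᵥ c) := by
  simp [cross_apply, dotProduct, Fin.sum_univ_three]
  ring

/-- Test with `χ φ`: the product rule for its curl produces `∇χ × φ`, and the scalar triple product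
moves that factor onto `u`. -/
theorem HasWeakCurl.smul {u c : VField} (h : HasWeakCurl Set.univ u c) {χ : Pt → ℂ}
    (hχ : ContDiff ℝ ∞ χ) :
    HasWeakCurl Set.univ (fun x => χ x • u x) (fun x => χ x • c x + grad χ x ⨯₃ u x) where
  field_L2 := h.field_L2.smul .univ hχ.continuous
  curl_L2 := (h.curl_L2.smul .univ hχ.continuous).add
    (h.field_L2.cross_left .univ (contDiff_grad hχ).continuous)
  test φ hφ hφc _ := by
    have hg := (contDiff_grad hχ).continuous
    have hs : ContDiff ℝ ∞ fun x => χ x • φ x := contDiff_pi.mpr fun j => hχ.mul (contDiff_apply_comp hφ j)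
    have hsc : HasCompactSupport fun x => χ x • φ x :=
      HasCompactSupport.intro hφc fun x hx => by
        rw [image_eq_zero_of_notMem_tsupport hx, smul_zero]
    have h1 := h.test _ hs hsc (Set.subset_univ _)
    have e1 : IntegrableOn (fun x => u x ⬝ᵥ curl (fun y => χ y • φ y) x) Set.univ :=
      h.field_L2.integrableOn_dotProduct_of_boundedSupport .univ
        (LocL2.of_continuous .univ (contDiff_curl hs).continuous)
        (.of_hasCompactSupport (hasCompactSupport_curl hsc))
    have e2 : IntegrableOn (fun x => (grad χ x ⨯₃ u x) ⬝ᵥ φ x) Set.univ :=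
      (h.field_L2.cross_left .univ hg).integrableOn_dotProduct_of_boundedSupport .univ
        (LocL2.of_continuous .univ hφ.continuous) (.of_hasCompactSupport hφc)
    have e3 : IntegrableOn (fun x => c x ⬝ᵥ (χ x • φ x)) Set.univ :=
      h.curl_L2.integrableOn_dotProduct_of_boundedSupport .univ
        (LocL2.of_continuous .univ hs.continuous) (.of_hasCompactSupport hsc)
    calc ∫ x in Set.univ, χ x • u x ⬝ᵥ curl φ x
        = ∫ x in Set.univ, (u x ⬝ᵥ curl (fun y => χ y • φ y) x + (grad χ x ⨯₃ u x) ⬝ᵥ φ x) := by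
          refine integral_congr_ae (Eventually.of_forall fun x => ?_)
          simp only
          rw [curl_smul hχ hφ, dotProduct_add, dotProduct_cross_right_comm, dotProduct_smul,
            smul_dotProduct]
          ring
      _ = ∫ x in Set.univ, (c x ⬝ᵥ (χ x • φ x) + (grad χ x ⨯₃ u x) ⬝ᵥ φ x) := by
          rw [integral_add e1 e2, h1, integral_add e3 e2]
      _ = ∫ x in Set.univ, (χ x • c x + grad χ x ⨯₃ u x) ⬝ᵥ φ x := by
          refine integral_congr_ae (Eventually.of_forall fun x => ?_)
          simp only
          rw [add_dotProduct, smul_dotProduct, dotProduct_smul]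

/-! ### Splitting the space into the object and its exterior -/

theorem isOpen_ext (B : Set Pt) : IsOpen (ext B) := isClosed_closure.isOpen_compl

theorem disjoint_ext (B : Set Pt) : Disjoint B (ext B) :=
  Set.disjoint_compl_right_iff_subset.mpr subset_closure

theorem union_ext_ae_eq_univ {B : Set Pt} (hBo : IsOpen B) (hBn : volume (frontier B) = 0) :
    (B ∪ ext B : Set Pt) =ᵐ[volume] Set.univ := by
  refine eventuallyEq_univ.mpr (mem_ae_iff.mpr (measure_mono_null (fun x hx => ?_) hBn))
  rw [Set.mem_compl_iff, Set.mem_union, not_or, ext, Set.mem_compl_iff, not_not] at hx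
  rw [frontier, hBo.interior_eq]
  exact ⟨hx.2, hx.1⟩

theorem integral_univ_eq_add {B : Set Pt} (hBo : IsOpen B) (hBn : volume (frontier B) = 0)
    {f : Pt → ℂ} (h1 : IntegrableOn f B) (h2 : IntegrableOn f (ext B)) :
    ∫ x, f x = (∫ x in B, f x) + ∫ x in ext B, f x := by
  rw [← setIntegral_union (disjoint_ext B) (isOpen_ext B).measurableSet h1 h2,
    setIntegral_congr_set (union_ext_ae_eq_univ hBo hBn), setIntegral_univ]

theorem LocL2.glue {B : Set Pt} (hBo : IsOpen B) (hBn : volume (frontier B) = 0) {F : VField}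
    (h1 : LocL2 B F) (h2 : LocL2 (ext B) F) : LocL2 Set.univ F := fun R => by
  have he : ((B ∪ ext B) ∩ Metric.ball (0 : Pt) R : Set Pt) =ᵐ[volume]
      (Set.univ ∩ Metric.ball (0 : Pt) R : Set Pt) :=
    (union_ext_ae_eq_univ hBo hBn).inter (ae_eq_refl _)
  rw [← Measure.restrict_congr_set he, Set.union_inter_distrib_right]
  have hm := aestronglyMeasurable_union_iff.mpr ⟨(h1 R).1, (h2 R).1⟩
  exact (memLp_two_iff_integrable_sq_norm hm).mpr <|
    IntegrableOn.union ((memLp_two_iff_integrable_sq_norm (h1 R).1).mp (h1 R))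
      ((memLp_two_iff_integrable_sq_norm (h2 R).1).mp (h2 R))

/-- A smooth test field is admissible in the jump condition, which then says that the defects of
Green's formula in `B` and in the exterior cancel. Hence one solution may serve as test field for
another across the boundary. -/
theorem HasWeakCurl.of_tangentialJump_zero {B : Set Pt} (hBo : IsOpen B)
    (hBn : volume (frontier B) = 0) {u c : VField} (h1 : HasWeakCurl B u c)
    (h2 : HasWeakCurl (ext B) u c) (hj : TangentialJump B u c 0) :
    HasWeakCurl Set.univ u c where
  field_L2 := h1.field_L2.glue hBo hBn h2.field_L2
  curl_L2 := h1.curl_L2.glue hBo hBn h2.curl_L2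
  test φ hφ hφc _ := by
    have hu := h1.field_L2.glue hBo hBn h2.field_L2
    have hc := h1.curl_L2.glue hBo hBn h2.curl_L2
    have iu : Integrable fun x => u x ⬝ᵥ curl φ x := integrableOn_univ.mp <|
      hu.integrableOn_dotProduct_of_boundedSupport .univ
        (LocL2.of_continuous .univ (contDiff_curl hφ).continuous)
        (.of_hasCompactSupport (hasCompactSupport_curl hφc))
    have ic : Integrable fun x => c x ⬝ᵥ φ x := integrableOn_univ.mp <|
      hc.integrableOn_dotProduct_of_boundedSupport .univ
        (LocL2.of_continuous .univ hφ.continuous) (.of_hasCompactSupport hφc)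
    have h := hj φ (curl φ) (hasWeakCurl_of_contDiff hφ) hφc
    have hsub : ∫ x, (c x ⬝ᵥ φ x - u x ⬝ᵥ curl φ x) = 0 := by
      have hi : Integrable fun x => c x ⬝ᵥ φ x - u x ⬝ᵥ curl φ x := ic.sub iu
      rw [integral_univ_eq_add hBo hBn hi.integrableOn hi.integrableOn]
      simp only [traceIn, traceOut, zero_dotProduct, sub_zero, integral_zero] at h
      linear_combination -h
    rw [setIntegral_univ, setIntegral_univ]
    exact (sub_eq_zero.mp ((integral_sub ic iu).symm.trans hsub)).symm

theorem LocL2.integrableOn_dotProduct_of_isBounded {B : Set Pt} (hBb : Bornology.IsBounded B)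
    {F G : VField} (hF : LocL2 B F) (hG : LocL2 B G) :
    IntegrableOn (fun x => F x ⬝ᵥ G x) B := by
  obtain ⟨ρ, hρ⟩ := hBb.subset_ball (0 : Pt)
  have := hF.integrableOn_dotProduct hG ρ
  rwa [Set.inter_eq_left.mpr hρ] at this

/-- The weak form of the transmission problem on the whole space. -/
theorem SolvesTransmission.weak_form {B : Set Pt} (hBo : IsOpen B)
    (hBn : volume (frontier B) = 0) {κ μr : ℝ} {εr : ℂ} {f : VField} {g : CVec} {u c : VField}
    (h : SolvesTransmission B κ μr εr f g u c) (hf : LocL2 Set.univ f)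
    {v Cv : VField} (hv : HasWeakCurl Set.univ v Cv)
    (hvc : HasCompactSupport v) (hCv : BoundedSupport Cv) :
    ∫ x, (coeff B (μr : ℂ)⁻¹ x * (c x ⬝ᵥ Cv x) - (κ : ℂ) ^ 2 * coeff B εr x * (u x ⬝ᵥ v x))
      = (∫ x in B, f x ⬝ᵥ v x) - ∫ x in B, g ⬝ᵥ Cv x := by
  obtain ⟨d, hd1, hd2, hB, hE, hj⟩ := h.curlcurl
  have mB := hBo.measurableSet
  have mE := (isOpen_ext B).measurableSet
  have hvb := BoundedSupport.of_hasCompactSupport hvc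
  have vB := hv.field_L2.mono (Set.subset_univ B)
  have vE := hv.field_L2.mono (Set.subset_univ (ext B))
  have CB := hv.curl_L2.mono (Set.subset_univ B)
  have CE := hv.curl_L2.mono (Set.subset_univ (ext B))
  have hj' := hj v Cv hv hvc
  have cB : ∀ (a : ℂ) x, x ∈ B → coeff B a x = a := fun a x hx => if_pos hx
  have cE : ∀ (a : ℂ) x, x ∈ ext B → coeff B a x = 1 := fun a x hx =>
    if_neg fun hxB => hx (subset_closure hxB)
  have i1 : IntegrableOn (fun x => d x ⬝ᵥ v x) B :=
    hd1.curl_L2.integrableOn_dotProduct_of_boundedSupport mB vB hvb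
  have i2 : IntegrableOn (fun x => d x ⬝ᵥ v x) (ext B) :=
    hd2.curl_L2.integrableOn_dotProduct_of_boundedSupport mE vE hvb
  -- Bounded support of `Cv` is a separate hypothesis: a weak curl is determined only up to null
  -- sets, so the support of `v` does not force `Cv` to vanish pointwise far away.
  have i3 : IntegrableOn (fun x => (coeff B (μr : ℂ)⁻¹ x • c x) ⬝ᵥ Cv x) B :=
    hd1.field_L2.integrableOn_dotProduct_of_boundedSupport mB CB hCv
  have i4 : IntegrableOn (fun x => (coeff B (μr : ℂ)⁻¹ x • c x) ⬝ᵥ Cv x) (ext B) :=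
    hd2.field_L2.integrableOn_dotProduct_of_boundedSupport mE CE hCv
  have i5 : IntegrableOn (fun x => f x ⬝ᵥ v x) B :=
    (hf.mono (Set.subset_univ B)).integrableOn_dotProduct_of_boundedSupport mB vB hvb
  -- By the equation in `B`, the energy density is the source minus the integrand of Green's
  -- formula; outside, the source is absent. The two Green integrals then combine into the jump
  -- datum.
  have eB : ∀ᵐ x ∂volume.restrict B,
      coeff B (μr : ℂ)⁻¹ x * (c x ⬝ᵥ Cv x) - (κ : ℂ) ^ 2 * coeff B εr x * (u x ⬝ᵥ v x)
        = f x ⬝ᵥ v x - (d x ⬝ᵥ v x - (coeff B (μr : ℂ)⁻¹ x • c x) ⬝ᵥ Cv x) := by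
    filter_upwards [hB, ae_restrict_mem mB] with x hx hxB
    rw [← hx, cB εr x hxB, sub_dotProduct, smul_dotProduct, smul_dotProduct, smul_eq_mul,
      smul_eq_mul]
    ring
  have eE : ∀ᵐ x ∂volume.restrict (ext B),
      coeff B (μr : ℂ)⁻¹ x * (c x ⬝ᵥ Cv x) - (κ : ℂ) ^ 2 * coeff B εr x * (u x ⬝ᵥ v x)
        = -(d x ⬝ᵥ v x - (coeff B (μr : ℂ)⁻¹ x • c x) ⬝ᵥ Cv x) := by
    filter_upwards [hE, ae_restrict_mem mE] with x hx hxE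
    rw [sub_eq_zero.mp hx, cE εr x hxE, smul_dotProduct, smul_dotProduct, smul_eq_mul,
      smul_eq_mul]
    ring
  have kB : IntegrableOn (fun x => coeff B (μr : ℂ)⁻¹ x * (c x ⬝ᵥ Cv x)
      - (κ : ℂ) ^ 2 * coeff B εr x * (u x ⬝ᵥ v x)) B :=
    (i5.sub (i1.sub i3)).congr (eB.mono fun x hx => hx.symm)
  have kE : IntegrableOn (fun x => coeff B (μr : ℂ)⁻¹ x * (c x ⬝ᵥ Cv x)
      - (κ : ℂ) ^ 2 * coeff B εr x * (u x ⬝ᵥ v x)) (ext B) :=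
    (i2.sub i4).neg.congr (eE.mono fun x hx => hx.symm)
  have hs : ∫ x in B, (f x ⬝ᵥ v x - (d x ⬝ᵥ v x - (coeff B (μr : ℂ)⁻¹ x • c x) ⬝ᵥ Cv x))
      = (∫ x in B, f x ⬝ᵥ v x)
        - ∫ x in B, (d x ⬝ᵥ v x - (coeff B (μr : ℂ)⁻¹ x • c x) ⬝ᵥ Cv x) :=
    integral_sub i5 (i1.sub i3)
  rw [integral_univ_eq_add hBo hBn kB kE, integral_congr_ae eB, integral_congr_ae eE,
    integral_neg, hs]
  simp only [traceIn, traceOut, zero_dotProduct, zero_sub, integral_neg] at hj'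
  linear_combination hj'

/-! ### A radial cutoff -/

/-- A smooth radial function that is `1` on the ball of radius `R` and vanishes outside the ball of
radius `2 R`. -/
def cutoff (R : ℝ) (x : Pt) : ℂ := ((Real.smoothTransition (2 - ‖x‖ ^ 2 / R ^ 2) : ℝ) : ℂ)

/-- The density `p` for which the cutoff has gradient `-p(x) x`. -/
def shellDensity (R : ℝ) (x : Pt) : ℝ :=
  deriv Real.smoothTransition (2 - ‖x‖ ^ 2 / R ^ 2) * (2 / R ^ 2)

theorem contDiff_cutoff (R : ℝ) : ContDiff ℝ ∞ (cutoff R) :=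
  Complex.ofRealCLM.contDiff.comp <| Real.smoothTransition.contDiff.comp <|
    contDiff_const.sub ((contDiff_norm_sq ℝ).div_const _)

theorem continuous_deriv_smoothTransition : Continuous (deriv Real.smoothTransition) :=
  (Real.smoothTransition.contDiff (n := 1)).continuous_deriv le_rfl

theorem continuous_shellDensity (R : ℝ) : Continuous (shellDensity R) := by
  have := continuous_deriv_smoothTransition
  unfold shellDensity
  fun_prop

theorem deriv_smoothTransition_nonneg (s : ℝ) : 0 ≤ deriv Real.smoothTransition s :=
  Real.smoothTransition.monotone.deriv_nonneg

theorem shellDensity_nonneg (R : ℝ) (x : Pt) : 0 ≤ shellDensity R x :=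
  mul_nonneg (deriv_smoothTransition_nonneg _) (by positivity)

theorem deriv_smoothTransition_of_one_lt {s : ℝ} (hs : 1 < s) :
    deriv Real.smoothTransition s = 0 := by
  have : Real.smoothTransition =ᶠ[𝓝 s] fun _ => 1 := by
    filter_upwards [lt_mem_nhds hs] with t ht using Real.smoothTransition.one_of_one_le ht.le
  rw [this.deriv_eq, deriv_const]

theorem deriv_smoothTransition_of_neg {s : ℝ} (hs : s < 0) :
    deriv Real.smoothTransition s = 0 := by
  have : Real.smoothTransition =ᶠ[𝓝 s] fun _ => 0 := by
    filter_upwards [gt_mem_nhds hs] with t ht using Real.smoothTransition.zero_of_nonpos ht.le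
  rw [this.deriv_eq, deriv_const]

theorem exists_deriv_smoothTransition_le : ∃ D, 0 ≤ D ∧ ∀ s, deriv Real.smoothTransition s ≤ D := by
  obtain ⟨C, hC⟩ := (isCompact_Icc (a := (0 : ℝ)) (b := 1)).exists_bound_of_continuousOn
    continuous_deriv_smoothTransition.continuousOn
  refine ⟨max C 0, le_max_right _ _, fun s => ?_⟩
  rcases lt_or_ge s 0 with h0 | h0
  · rw [deriv_smoothTransition_of_neg h0]
    exact le_max_right _ _
  rcases lt_or_ge 1 s with h1 | h1
  · rw [deriv_smoothTransition_of_one_lt h1]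
    exact le_max_right _ _
  exact ((le_abs_self _).trans (hC s ⟨h0, h1⟩)).trans (le_max_left _ _)

theorem cutoff_of_norm_lt {R : ℝ} {x : Pt} (h : ‖x‖ < R) : cutoff R x = 1 := by
  have hR : 0 < R := (norm_nonneg x).trans_lt h
  have : ‖x‖ ^ 2 / R ^ 2 ≤ 1 := (div_le_one (by positivity)).mpr (by gcongr)
  rw [cutoff, Real.smoothTransition.one_of_one_le (by linarith), Complex.ofReal_one]

theorem two_sub_div_neg_of_two_mul_le {R : ℝ} (hR : 0 < R) {x : Pt} (h : 2 * R ≤ ‖x‖) :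
    2 - ‖x‖ ^ 2 / R ^ 2 < 0 := by
  -- The cutoff already vanishes beyond `√2 R`; the radius `2 R` avoids the root and leaves the
  -- argument strictly negative, so the derivative vanishes too.
  have : 4 ≤ ‖x‖ ^ 2 / R ^ 2 := by
    rw [le_div_iff₀ (by positivity)]
    nlinarith
  linarith

theorem cutoff_of_two_mul_le {R : ℝ} (hR : 0 < R) {x : Pt} (h : 2 * R ≤ ‖x‖) : cutoff R x = 0 := by
  rw [cutoff, Real.smoothTransition.zero_of_nonpos (two_sub_div_neg_of_two_mul_le hR h).le,
    Complex.ofReal_zero]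

theorem shellDensity_of_norm_lt {R : ℝ} {x : Pt} (h : ‖x‖ < R) : shellDensity R x = 0 := by
  have hR : 0 < R := (norm_nonneg x).trans_lt h
  have : ‖x‖ ^ 2 / R ^ 2 < 1 := (div_lt_one (by positivity)).mpr (by gcongr)
  rw [shellDensity, deriv_smoothTransition_of_one_lt (by linarith), zero_mul]

theorem shellDensity_of_two_mul_le {R : ℝ} (hR : 0 < R) {x : Pt} (h : 2 * R ≤ ‖x‖) :
    shellDensity R x = 0 := by
  rw [shellDensity, deriv_smoothTransition_of_neg (two_sub_div_neg_of_two_mul_le hR h), zero_mul]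

/-- Depending on `‖x‖ ^ 2` rather than on the norm keeps the cutoff smooth at the origin and its
gradient a multiple of `x`, which matches the form of the radiation condition. -/
theorem grad_cutoff (R : ℝ) (x : Pt) :
    grad (cutoff R) x = (-(shellDensity R x : ℂ)) • vec x := by
  have h1 : HasFDerivAt (fun w : Pt => 2 - ‖w‖ ^ 2 / R ^ 2)
      (-((R ^ 2)⁻¹ • (2 • innerSL ℝ x))) x := by
    have := ((hasStrictFDerivAt_norm_sq x).hasFDerivAt.const_mul (R ^ 2)⁻¹).const_sub 2
    simpa only [div_eq_inv_mul] using this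
  have hs : HasDerivAt Real.smoothTransition
      (deriv Real.smoothTransition (2 - ‖x‖ ^ 2 / R ^ 2)) (2 - ‖x‖ ^ 2 / R ^ 2) :=
    ((Real.smoothTransition.contDiff (n := 1)).differentiable (by simp) _).hasDerivAt
  have h2 := Complex.ofRealCLM.hasFDerivAt.comp x (hs.hasFDerivAt.comp x h1)
  funext j
  have h3 : pd j (cutoff R) x = _ :=
    congrArg (fun L : Pt →L[ℝ] ℂ => L (EuclideanSpace.single j 1)) h2.fderiv
  rw [grad, h3]
  simp [EuclideanSpace.inner_single_right, shellDensity, vec]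
  ring

theorem boundedSupport_cutoff_smul {R : ℝ} (hR : 0 < R) (F : VField) :
    BoundedSupport fun x => cutoff R x • F x :=
  ⟨2 * R, fun x hx => by
    beta_reduce
    rw [cutoff_of_two_mul_le hR hx, zero_smul]⟩

theorem boundedSupport_grad_cutoff_cross {R : ℝ} (hR : 0 < R) (F : VField) :
    BoundedSupport fun x => grad (cutoff R) x ⨯₃ F x :=
  ⟨2 * R, fun x hx => by
    beta_reduce
    rw [grad_cutoff, shellDensity_of_two_mul_le hR hx, Complex.ofReal_zero, neg_zero, zero_smul,
      map_zero, LinearMap.zero_apply]⟩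

theorem BoundedSupport.add {F G : VField} (hF : BoundedSupport F) (hG : BoundedSupport G) :
    BoundedSupport fun x => F x + G x := by
  obtain ⟨R, hR⟩ := hF
  obtain ⟨S, hS⟩ := hG
  exact ⟨max R S, fun x hx => by
    beta_reduce
    rw [hR x ((le_max_left _ _).trans hx), hS x ((le_max_right _ _).trans hx), add_zero]⟩

theorem hasCompactSupport_cutoff {R : ℝ} (hR : 0 < R) : HasCompactSupport (cutoff R) :=
  HasCompactSupport.intro (isCompact_closedBall (0 : Pt) (2 * R)) fun x hx =>
    cutoff_of_two_mul_le hR (by simpa using (not_le.mp fun h => hx (by simpa using h)).le)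

theorem integrable_shellDensity {R : ℝ} (hR : 0 < R) : Integrable (shellDensity R) :=
  (continuous_shellDensity R).integrable_of_hasCompactSupport <|
    HasCompactSupport.intro (isCompact_closedBall (0 : Pt) (2 * R)) fun x hx =>
      shellDensity_of_two_mul_le hR (by simpa using (not_le.mp fun h => hx (by simpa using h)).le)

/-- The density is of order `R⁻²` on a ball of volume of order `R³`. This linear growth is later
compensated by a factor `1 / R`. -/
theorem exists_integral_shellDensity_le :
    ∃ C, 0 ≤ C ∧ ∀ R, 0 < R → ∫ x, shellDensity R x ≤ C * R := by
  obtain ⟨D, hD, h⟩ := exists_deriv_smoothTransition_le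
  -- The factor `16` is `2 · 8`: `2 / R ^ 2` from the density, `8 R ^ 3` from the volume of the
  -- ball.
  refine ⟨16 * D * volume.real (Metric.ball (0 : Pt) 1), by positivity, fun R hR => ?_⟩
  have hv : volume.real (Metric.ball (0 : Pt) (2 * R))
      = 8 * R ^ 3 * volume.real (Metric.ball (0 : Pt) 1) := by
    rw [Measure.real, Measure.addHaar_ball_of_pos _ _ (by positivity), ENNReal.toReal_mul,
      ENNReal.toReal_ofReal (by positivity), finrank_euclideanSpace_fin, Measure.real]
    ring
  have h0 : ∀ x ∉ Metric.ball (0 : Pt) (2 * R), shellDensity R x = 0 := fun x hx =>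
    shellDensity_of_two_mul_le hR (by simpa using hx)
  rw [← setIntegral_eq_integral_of_forall_compl_eq_zero h0]
  have hb : ∀ x, shellDensity R x ≤ D * (2 / R ^ 2) := fun x =>
    mul_le_mul_of_nonneg_right (h _) (by positivity)
  calc ∫ x in Metric.ball (0 : Pt) (2 * R), shellDensity R x
      ≤ ∫ _x in Metric.ball (0 : Pt) (2 * R), D * (2 / R ^ 2) :=
        integral_mono (integrable_shellDensity hR).integrableOn
          (integrableOn_const measure_ball_lt_top.ne) hb
    _ = 16 * D * volume.real (Metric.ball (0 : Pt) 1) * R := by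
        rw [setIntegral_const, hv, smul_eq_mul]
        field_simp
        ring

/-! ### Radiating fields in a large shell -/

/-- The squared Euclidean norm of a complex vector. -/
def normSq (a : CVec) : ℝ := ∑ j, ‖a j‖ ^ 2

theorem dotProduct_star_eq_normSq (a : CVec) : a ⬝ᵥ star a = (normSq a : ℂ) := by
  simp only [dotProduct, Pi.star_apply, normSq, Complex.ofReal_sum, Complex.ofReal_pow]
  exact Finset.sum_congr rfl fun j _ => Complex.mul_conj' (a j)

theorem star_dotProduct_eq_normSq (a : CVec) : star a ⬝ᵥ a = (normSq a : ℂ) := by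
  rw [dotProduct_comm, dotProduct_star_eq_normSq]

theorem normSq_star (a : CVec) : normSq (star a) = normSq a := by
  simp [normSq]

/-- Young's inequality in each component. Since `‖b‖` is the supremum norm, the three components
contribute `3/4` of `‖b‖ ^ 2 / δ`, which is rounded up. -/
theorem norm_dotProduct_le (a b : CVec) {δ : ℝ} (hδ : 0 < δ) :
    ‖a ⬝ᵥ b‖ ≤ δ * normSq a + ‖b‖ ^ 2 / δ := by
  have h : ∀ j, ‖a j * b j‖ ≤ δ * ‖a j‖ ^ 2 + ‖b‖ ^ 2 / (4 * δ) := fun j => by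
    rw [norm_mul]
    have h1 : ‖a j‖ * ‖b j‖ ≤ ‖a j‖ * ‖b‖ :=
      mul_le_mul_of_nonneg_left (norm_le_pi_norm b j) (norm_nonneg _)
    have h2 : δ * ‖a j‖ ^ 2 + ‖b‖ ^ 2 / (4 * δ) - ‖a j‖ * ‖b‖
        = (2 * δ * ‖a j‖ - ‖b‖) ^ 2 / (4 * δ) := by
      field_simp
      ring
    have h3 : 0 ≤ (2 * δ * ‖a j‖ - ‖b‖) ^ 2 / (4 * δ) := by positivity
    linarith
  have h4 : ‖b‖ ^ 2 / (4 * δ) * 3 ≤ ‖b‖ ^ 2 / δ := by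
    rw [div_mul_eq_mul_div, div_le_div_iff₀ (by positivity) hδ]
    nlinarith [mul_nonneg (sq_nonneg ‖b‖) hδ.le]
  calc ‖a ⬝ᵥ b‖ ≤ ∑ j, ‖a j * b j‖ := norm_sum_le _ _
    _ ≤ ∑ j : Fin 3, (δ * ‖a j‖ ^ 2 + ‖b‖ ^ 2 / (4 * δ)) := Finset.sum_le_sum fun j _ => h j
    _ = δ * normSq a + ‖b‖ ^ 2 / (4 * δ) * 3 := by
        rw [Finset.sum_add_distrib, normSq, ← Finset.mul_sum, Finset.sum_const, Finset.card_univ,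
          Fintype.card_fin]
        ring
    _ ≤ _ := by linarith

/-- The field `|x| (c × x̂ - i κ u)`, which tends to zero for radiating fields. -/
def radiationField (κ : ℝ) (u c : VField) (x : Pt) : CVec :=
  c x ⨯₃ vec x - (Complex.I * (κ : ℂ) * ((‖x‖ : ℝ) : ℂ)) • u x

theorem Radiating.eventually_norm_le {κ : ℝ} {u c : VField} (h : Radiating κ u c) {η : ℝ}
    (hη : 0 < η) :
    ∀ᶠ R : ℝ in atTop, ∀ᵐ x : Pt, R ≤ ‖x‖ → ‖radiationField κ u c x‖ ≤ η := by
  have h1 := (Metric.tendsto_nhds.mp h) η hη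
  -- A neighbourhood in the infimum filter splits into the complement of a ball, which fixes the
  -- radius, and a set of full measure.
  obtain ⟨S, hS, T, hT, hST⟩ := mem_inf_iff_superset.mp h1
  obtain ⟨r, hr⟩ := (Metric.mem_cocompact_iff_closedBall_compl_subset (0 : Pt)).mp hS
  filter_upwards [eventually_gt_atTop (max r 0)] with R hR
  filter_upwards [hT] with x hxT hxR
  have hx0 : 0 < ‖x‖ := ((le_max_right _ _).trans_lt hR).trans_le hxR
  have hxS : x ∈ S := hr fun hx => by
    rw [mem_closedBall_zero_iff] at hx
    linarith [le_max_left r 0]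
  have h2 : dist (((‖x‖ : ℝ) : ℂ) •
      (c x ⨯₃ vec (‖x‖⁻¹ • x) - (Complex.I * (κ : ℂ)) • u x)) 0 < η := hST ⟨hxS, hxT⟩
  have hne : ((‖x‖ : ℝ) : ℂ) ≠ 0 := by exact_mod_cast hx0.ne'
  have hv : vec x = ((‖x‖ : ℝ) : ℂ) • vec (‖x‖⁻¹ • x) := by
    funext j
    simp [vec, hne]
  have h3 : radiationField κ u c x = ((‖x‖ : ℝ) : ℂ) •
      (c x ⨯₃ vec (‖x‖⁻¹ • x) - (Complex.I * (κ : ℂ)) • u x) := by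
    rw [radiationField, smul_sub, ← map_smul, ← hv, smul_smul]
    ring_nf
  rw [h3]
  rw [dist_zero_right] at h2
  exact h2.le

/-- The weighted energy `∫ p |x| |w|²` of a field in the shell where the cutoff varies. -/
def shellEnergy (R : ℝ) (w : VField) : ℝ := ∫ x, shellDensity R x * ‖x‖ * normSq (w x)

theorem shellEnergy_star (R : ℝ) (w : VField) :
    shellEnergy R (fun x => star (w x)) = shellEnergy R w := by
  simp only [shellEnergy, normSq_star]

theorem integrable_shell_dotProduct {R : ℝ} (hR : 0 < R) {u w : VField}
    (hu : LocL2 Set.univ u) (hw : LocL2 Set.univ w) :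
    Integrable fun x => ((shellDensity R x * ‖x‖ : ℝ) : ℂ) * (w x ⬝ᵥ u x) := by
  have hc : Continuous fun x : Pt => ((shellDensity R x * ‖x‖ : ℝ) : ℂ) :=
    Complex.continuous_ofReal.comp ((continuous_shellDensity R).mul continuous_norm)
  have hb : BoundedSupport fun x => ((shellDensity R x * ‖x‖ : ℝ) : ℂ) • u x :=
    ⟨2 * R, fun x hx => by
      beta_reduce
      rw [shellDensity_of_two_mul_le hR hx, zero_mul, Complex.ofReal_zero, zero_smul]⟩
  have h := integrableOn_univ.mp
    (hw.integrableOn_dotProduct_of_boundedSupport .univ (hu.smul .univ hc) hb)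
  simpa only [dotProduct_smul, smul_eq_mul] using h

theorem shell_dotProduct_star (R : ℝ) (w : VField) (x : Pt) :
    ((shellDensity R x * ‖x‖ : ℝ) : ℂ) * (w x ⬝ᵥ star (w x))
      = ((shellDensity R x * ‖x‖ * normSq (w x) : ℝ) : ℂ) := by
  rw [dotProduct_star_eq_normSq, ← Complex.ofReal_mul]

theorem integrable_shellEnergy {R : ℝ} (hR : 0 < R) {w : VField} (hw : LocL2 Set.univ w) :
    Integrable fun x => shellDensity R x * ‖x‖ * normSq (w x) := by
  have h := (integrable_shell_dotProduct hR hw.conj hw).re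
  simp only [shell_dotProduct_star] at h
  exact h

/-- Young's inequality with weight `δ ‖x‖` bounds the pairing by the shell energy density of `w` and
a term of size `δ / R`, whose integral against the shell density is at most `δ C`. The threshold for
`R` does not depend on `w`. -/
theorem Radiating.eventually_norm_integral_le {κ : ℝ} {u c : VField} (h : Radiating κ u c)
    {C : ℝ} (hC : ∀ R, 0 < R → ∫ x, shellDensity R x ≤ C * R) {δ : ℝ} (hδ : 0 < δ) :
    ∀ᶠ R : ℝ in atTop, ∀ w : VField, LocL2 Set.univ w →
      ‖∫ x, (shellDensity R x : ℂ) * (w x ⬝ᵥ radiationField κ u c x)‖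
        ≤ δ * shellEnergy R w + δ * C := by
  filter_upwards [h.eventually_norm_le hδ, eventually_gt_atTop 0] with R hη hR w hw
  have hi : Integrable fun x => δ * (shellDensity R x * ‖x‖ * normSq (w x))
      + δ / R * shellDensity R x :=
    ((integrable_shellEnergy hR hw).const_mul δ).add ((integrable_shellDensity hR).const_mul _)
  have hb : ∀ᵐ x : Pt, ‖(shellDensity R x : ℂ) * (w x ⬝ᵥ radiationField κ u c x)‖
      ≤ δ * (shellDensity R x * ‖x‖ * normSq (w x)) + δ / R * shellDensity R x := by
    filter_upwards [hη] with x hx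
    rcases lt_or_ge ‖x‖ R with hlt | hge
    · simp [shellDensity_of_norm_lt hlt]
    have hx0 : 0 < ‖x‖ := hR.trans_le hge
    have hp := shellDensity_nonneg R x
    have h1 := norm_dotProduct_le (w x) (radiationField κ u c x) (mul_pos hδ hx0)
    have h2 : ‖radiationField κ u c x‖ ^ 2 / (δ * ‖x‖) ≤ δ / R := by
      have h3 : ‖radiationField κ u c x‖ ^ 2 ≤ δ ^ 2 :=
        pow_le_pow_left₀ (norm_nonneg _) (hx hge) 2
      calc ‖radiationField κ u c x‖ ^ 2 / (δ * ‖x‖) ≤ δ ^ 2 / (δ * R) := by gcongr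
        _ = δ / R := by field_simp
    rw [norm_mul, Complex.norm_real, Real.norm_of_nonneg hp]
    calc shellDensity R x * ‖w x ⬝ᵥ radiationField κ u c x‖
        ≤ shellDensity R x * (δ * ‖x‖ * normSq (w x) + δ / R) :=
          mul_le_mul_of_nonneg_left (by linarith) hp
      _ = _ := by ring
  refine (norm_integral_le_of_norm_le hi hb).trans ?_
  rw [integral_add ((integrable_shellEnergy hR hw).const_mul δ)
    ((integrable_shellDensity hR).const_mul _), integral_const_mul, integral_const_mul]
  have h4 : δ / R * ∫ x, shellDensity R x ≤ δ / R * (C * R) :=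
    mul_le_mul_of_nonneg_left (hC R hR) (by positivity)
  have h5 : δ / R * (C * R) = δ * C := by field_simp
  rw [h5] at h4
  exact add_le_add le_rfl h4

/-- Cyclic invariance gives `c · (x × w) = w · (c × x)`, and `c × x` is the radiation field plus `iκ
|x| u`. The main part is symmetric in `u` and `w`. -/
theorem dotProduct_grad_cutoff_cross (κ R : ℝ) (u c w : VField) (x : Pt) :
    c x ⬝ᵥ (grad (cutoff R) x ⨯₃ w x)
      = -((shellDensity R x : ℂ) * (w x ⬝ᵥ radiationField κ u c x))
        - Complex.I * κ * (((shellDensity R x * ‖x‖ : ℝ) : ℂ) * (w x ⬝ᵥ u x)) := by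
  rw [grad_cutoff, map_smul, LinearMap.smul_apply, dotProduct_smul, triple_product_permutation,
    triple_product_permutation, radiationField, dotProduct_sub, dotProduct_smul]
  simp only [smul_eq_mul, Complex.ofReal_mul]
  ring

theorem integrable_dotProduct_grad_cutoff_cross {R : ℝ} (hR : 0 < R) {c w : VField}
    (hc : LocL2 Set.univ c) (hw : LocL2 Set.univ w) :
    Integrable fun x => c x ⬝ᵥ (grad (cutoff R) x ⨯₃ w x) :=
  integrableOn_univ.mp <| hc.integrableOn_dotProduct_of_boundedSupport .univ
    (hw.cross_left .univ (contDiff_grad (contDiff_cutoff R)).continuous)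
    (boundedSupport_grad_cutoff_cross hR w)

theorem integral_dotProduct_grad_cutoff_cross (κ : ℝ) {R : ℝ} (hR : 0 < R) {u c w : VField}
    (hu : LocL2 Set.univ u) (hc : LocL2 Set.univ c) (hw : LocL2 Set.univ w) :
    ∫ x, c x ⬝ᵥ (grad (cutoff R) x ⨯₃ w x)
      = -(∫ x, (shellDensity R x : ℂ) * (w x ⬝ᵥ radiationField κ u c x))
        - Complex.I * κ * ∫ x, ((shellDensity R x * ‖x‖ : ℝ) : ℂ) * (w x ⬝ᵥ u x) := by
  have i1 := integrable_dotProduct_grad_cutoff_cross hR hc hw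
  have i2 := (integrable_shell_dotProduct hR hu hw).const_mul (Complex.I * κ)
  have he : ∀ x, (shellDensity R x : ℂ) * (w x ⬝ᵥ radiationField κ u c x)
      = -(c x ⬝ᵥ (grad (cutoff R) x ⨯₃ w x))
        - Complex.I * κ * (((shellDensity R x * ‖x‖ : ℝ) : ℂ) * (w x ⬝ᵥ u x)) := fun x => by
    rw [dotProduct_grad_cutoff_cross κ R u c w x]
    ring
  have h : ∫ x, (shellDensity R x : ℂ) * (w x ⬝ᵥ radiationField κ u c x)
      = -(∫ x, c x ⬝ᵥ (grad (cutoff R) x ⨯₃ w x))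
        - Complex.I * κ * ∫ x, ((shellDensity R x * ‖x‖ : ℝ) : ℂ) * (w x ⬝ᵥ u x) := by
    rw [← integral_const_mul, ← integral_neg]
    simp only [he]
    exact integral_sub i1.neg i2
  rw [h]
  ring

/-! ### Reciprocity for the transmission problem -/

theorem LocL2.coeff_smul {B : Set Pt} (hB : MeasurableSet B) {F : VField}
    (hF : LocL2 Set.univ F) (a : ℂ) : LocL2 Set.univ fun x => coeff B a x • F x := by
  have hm : Measurable (coeff B a) := Measurable.ite hB measurable_const measurable_const
  refine hF.of_norm_le_mul (f := fun _ => max ‖a‖ 1) .univ continuous_const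
    (fun R => hm.aestronglyMeasurable.smul (hF R).1) fun x => ?_
  rw [norm_smul]
  refine mul_le_mul_of_nonneg_right ?_ (norm_nonneg _)
  by_cases hx : x ∈ B <;> simp [coeff, hx]

/-- The bilinear form of the transmission problem, as a density. -/
def energyDensity (B : Set Pt) (κ μr : ℝ) (εr : ℂ) (u c w cw : VField) (x : Pt) : ℂ :=
  coeff B (μr : ℂ)⁻¹ x * (c x ⬝ᵥ cw x) - (κ : ℂ) ^ 2 * coeff B εr x * (u x ⬝ᵥ w x)

/-- Absence of conjugation is what gives symmetry even for complex `εr`. -/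
theorem energyDensity_comm (B : Set Pt) (κ μr : ℝ) (εr : ℂ) (u c w cw : VField) (x : Pt) :
    energyDensity B κ μr εr u c w cw x = energyDensity B κ μr εr w cw u c x := by
  rw [energyDensity, energyDensity, dotProduct_comm (c x), dotProduct_comm (u x)]

theorem integrable_cutoff_mul_energyDensity {B : Set Pt} (hB : MeasurableSet B) {κ μr : ℝ} {εr : ℂ}
    {u c w cw : VField} (hu : LocL2 Set.univ u) (hc : LocL2 Set.univ c) (hw : LocL2 Set.univ w)
    (hcw : LocL2 Set.univ cw) {R : ℝ} (hR : 0 < R) :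
    Integrable fun x => cutoff R x * energyDensity B κ μr εr u c w cw x := by
  have hχ := (contDiff_cutoff R).continuous
  have i1 := integrableOn_univ.mp <| (hc.coeff_smul hB
    (μr : ℂ)⁻¹).integrableOn_dotProduct_of_boundedSupport .univ (hcw.smul .univ hχ)
      (boundedSupport_cutoff_smul hR cw)
  have i2 := integrableOn_univ.mp <| (hu.coeff_smul hB
    εr).integrableOn_dotProduct_of_boundedSupport .univ (hw.smul .univ hχ)
      (boundedSupport_cutoff_smul hR w)
  refine (i1.sub (i2.const_mul ((κ : ℂ) ^ 2))).congr (Eventually.of_forall fun x => ?_)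
  simp only [Pi.sub_apply, energyDensity, smul_dotProduct, dotProduct_smul, smul_eq_mul]
  ring

theorem grad_cutoff_of_mem {B : Set Pt} {ρ R : ℝ} (hB : B ⊆ Metric.ball 0 ρ) (hR : ρ ≤ R) {x : Pt}
    (hx : x ∈ B) : grad (cutoff R) x = 0 := by
  have := mem_ball_zero_iff.mp (hB hx)
  rw [grad_cutoff, shellDensity_of_norm_lt (this.trans_le hR), Complex.ofReal_zero, neg_zero,
    zero_smul]

theorem SolvesTransmission.hasWeakCurl {B : Set Pt} (hBo : IsOpen B)
    (hBn : volume (frontier B) = 0) {κ μr : ℝ} {εr : ℂ} {f : VField} {g : CVec} {u c : VField}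
    (h : SolvesTransmission B κ μr εr f g u c) : HasWeakCurl Set.univ u c :=
  .of_tangentialJump_zero hBo hBn h.curl_in h.curl_out h.jump

/-- The weak form is tested with `χ w`. Once the ball of radius `R` contains `B`, the cutoff is `1`
there and the source terms do not feel it. -/
theorem SolvesTransmission.cutoff_weak_form {B : Set Pt} (hBo : IsOpen B)
    (hBn : volume (frontier B) = 0) {ρ : ℝ} (hBρ : B ⊆ Metric.ball 0 ρ) {κ μr : ℝ} {εr : ℂ}
    {f : VField} {g : CVec} {u c : VField} (h : SolvesTransmission B κ μr εr f g u c)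
    (hf : LocL2 Set.univ f) {w cw : VField} (hw : HasWeakCurl Set.univ w cw) {R : ℝ} (hR : 0 < R)
    (hρR : ρ ≤ R) :
    (∫ x, cutoff R x * energyDensity B κ μr εr u c w cw x)
        + ∫ x, c x ⬝ᵥ (grad (cutoff R) x ⨯₃ w x)
      = (∫ x in B, f x ⬝ᵥ w x) - ∫ x in B, g ⬝ᵥ cw x := by
  have hu := h.hasWeakCurl hBo hBn
  have hvc : HasCompactSupport fun x => cutoff R x • w x :=
    HasCompactSupport.intro (hasCompactSupport_cutoff hR) fun x hx => by
      rw [image_eq_zero_of_notMem_tsupport hx, zero_smul]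
  have h1 := h.weak_form hBo hBn hf (hw.smul (contDiff_cutoff R)) hvc
    ((boundedSupport_cutoff_smul hR cw).add (boundedSupport_grad_cutoff_cross hR w))
  have hone : ∀ x ∈ B, cutoff R x = 1 := fun x hx =>
    cutoff_of_norm_lt ((mem_ball_zero_iff.mp (hBρ hx)).trans_le hρR)
  have hgrad : ∀ x ∈ B, grad (cutoff R) x = 0 := fun x hx => grad_cutoff_of_mem hBρ hρR hx
  have r1 : ∫ x in B, f x ⬝ᵥ (cutoff R x • w x) = ∫ x in B, f x ⬝ᵥ w x :=
    setIntegral_congr_fun hBo.measurableSet fun x hx => by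
      rw [hone x hx, one_smul]
  have r2 : ∫ x in B, g ⬝ᵥ (cutoff R x • cw x + grad (cutoff R) x ⨯₃ w x)
      = ∫ x in B, g ⬝ᵥ cw x :=
    setIntegral_congr_fun hBo.measurableSet fun x hx => by
      rw [hone x hx, one_smul, hgrad x hx, map_zero, LinearMap.zero_apply, add_zero]
  rw [← r1, ← r2, ← h1, ← integral_add
    (integrable_cutoff_mul_energyDensity hBo.measurableSet hu.field_L2 hu.curl_L2 hw.field_L2
      hw.curl_L2 hR) (integrable_dotProduct_grad_cutoff_cross hR hu.curl_L2 hw.field_L2)]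
  refine integral_congr_ae (Eventually.of_forall fun x => ?_)
  simp only [energyDensity, dotProduct_add, dotProduct_smul, smul_eq_mul]
  -- The term with `∇χ` lives outside `B`, where the coefficient is `1`; this is why no permeability
  -- appears in front of it.
  by_cases hx : x ∈ B
  · rw [hgrad x hx, map_zero, LinearMap.zero_apply, dotProduct_zero]
    ring
  · rw [show coeff B (μr : ℂ)⁻¹ x = 1 from if_neg hx]
    ring

/-- Paired with the conjugate field, the density is real except for the contribution of `εr` inside
`B`. Its imaginary part thus integrates to a number independent of `R`. -/
theorem integral_im_cutoff_mul_energyDensity_star {B : Set Pt} (hB : MeasurableSet B) {ρ : ℝ}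
    (hBρ : B ⊆ Metric.ball 0 ρ) {κ μr : ℝ} {εr : ℂ} {u c : VField} (hu : LocL2 Set.univ u)
    (hc : LocL2 Set.univ c) {R : ℝ} (hR : 0 < R) (hρR : ρ ≤ R) :
    (∫ x, cutoff R x * energyDensity B κ μr εr u c (fun y => star (u y))
        (fun y => star (c y)) x).im
      = ∫ x in B, -(κ ^ 2 * εr.im * normSq (u x)) := by
  have hi := integrable_cutoff_mul_energyDensity (κ := κ) (μr := μr) (εr := εr) hB hu hc hu.conj
    hc.conj hR
  have him : ∀ x, (cutoff R x * energyDensity B κ μr εr u c (fun y => star (u y))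
      (fun y => star (c y)) x).im
      = (Real.smoothTransition (2 - ‖x‖ ^ 2 / R ^ 2))
        * -(κ ^ 2 * (coeff B εr x).im * normSq (u x)) := fun x => by
    have hμ : (coeff B (μr : ℂ)⁻¹ x).im = 0 := by
      by_cases hx : x ∈ B <;> simp [coeff, hx, ← Complex.ofReal_inv]
    rw [cutoff, Complex.im_ofReal_mul, energyDensity, dotProduct_star_eq_normSq,
      dotProduct_star_eq_normSq, Complex.sub_im, Complex.im_mul_ofReal, Complex.im_mul_ofReal, hμ,
      ← Complex.ofReal_pow, Complex.im_ofReal_mul]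
    ring
  have h1 : (∫ x, cutoff R x * energyDensity B κ μr εr u c (fun y => star (u y))
        (fun y => star (c y)) x).im
      = ∫ x, (cutoff R x * energyDensity B κ μr εr u c (fun y => star (u y))
        (fun y => star (c y)) x).im := (integral_im hi).symm
  rw [h1, ← setIntegral_eq_integral_of_forall_compl_eq_zero (s := B) fun x hx => by
    rw [him, coeff, if_neg hx, Complex.one_im]
    ring]
  refine setIntegral_congr_fun hB fun x hx => ?_
  have hone : cutoff R x = 1 :=
    cutoff_of_norm_lt ((mem_ball_zero_iff.mp (hBρ hx)).trans_le hρR)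
  rw [cutoff, Complex.ofReal_eq_one] at hone
  rw [him, hone, coeff, if_pos hx, one_mul]

/-- Testing with the conjugate of `u` and taking imaginary parts expresses `κ` times the shell
energy through quantities independent of `R` and the radiation remainder. With `δ = κ / 2`, half of
the energy absorbs the remainder. -/
theorem SolvesTransmission.exists_shellEnergy_le {B : Set Pt} (hBo : IsOpen B)
    (hBb : Bornology.IsBounded B) (hBn : volume (frontier B) = 0) {κ μr : ℝ} (hκ : 0 < κ) {εr : ℂ}
    {f : VField} {g : CVec} {u c : VField} (h : SolvesTransmission B κ μr εr f g u c)
    (hf : LocL2 Set.univ f) :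
    ∃ K, ∀ᶠ R : ℝ in atTop, shellEnergy R u ≤ K := by
  obtain ⟨ρ, hρ⟩ := hBb.subset_ball (0 : Pt)
  obtain ⟨C, -, hC⟩ := exists_integral_shellDensity_le
  have hu := h.hasWeakCurl hBo hBn
  set L : ℂ := (∫ x in B, f x ⬝ᵥ star (u x)) - ∫ x in B, g ⬝ᵥ star (c x) with hL
  set A : ℝ := ∫ x in B, -(κ ^ 2 * εr.im * normSq (u x)) with hA
  refine ⟨(A - L.im + κ / 2 * C) / (κ / 2), ?_⟩
  filter_upwards [h.radiation.eventually_norm_integral_le hC (half_pos hκ), eventually_ge_atTop ρ,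
    eventually_gt_atTop 0] with R hV hρR hR
  have h1 := h.cutoff_weak_form hBo hBn hρ hf hu.conj hR hρR
  rw [integral_dotProduct_grad_cutoff_cross κ hR hu.field_L2 hu.curl_L2 hu.field_L2.conj] at h1
  have h2 := congrArg Complex.im h1
  have h3 : ∫ x, ((shellDensity R x * ‖x‖ : ℝ) : ℂ) * (star (u x) ⬝ᵥ u x)
      = ((shellEnergy R u : ℝ) : ℂ) := by
    rw [shellEnergy, ← integral_complex_ofReal]
    simp only [star_dotProduct_eq_normSq, Complex.ofReal_mul]
  have h4 := hV _ hu.field_L2.conj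
  rw [shellEnergy_star] at h4
  rw [Complex.add_im, integral_im_cutoff_mul_energyDensity_star hBo.measurableSet hρ hu.field_L2
    hu.curl_L2 hR hρR, h3, Complex.sub_im, Complex.neg_im, ← hL, ← hA] at h2
  have h5 : (Complex.I * (κ : ℂ) * ((shellEnergy R u : ℝ) : ℂ)).im = κ * shellEnergy R u := by
    simp
  rw [h5] at h2
  have h6 := (abs_le.mp ((Complex.abs_im_le_norm _).trans h4)).1
  rw [le_div_iff₀ (half_pos hκ)]
  linarith

/-- The reciprocity relation between two solutions of the transmission problem. -/
theorem SolvesTransmission.reciprocity {B : Set Pt} (hBo : IsOpen B)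
    (hBb : Bornology.IsBounded B) (hBn : volume (frontier B) = 0) {κ μr : ℝ} (hκ : 0 < κ) {εr : ℂ}
    {f f' : VField} {g g' : CVec} {u c u' c' : VField} (h : SolvesTransmission B κ μr εr f g u c)
    (h' : SolvesTransmission B κ μr εr f' g' u' c') (hf : LocL2 Set.univ f)
    (hf' : LocL2 Set.univ f') :
    (∫ x in B, f x ⬝ᵥ u' x) - ∫ x in B, g ⬝ᵥ c' x
      = (∫ x in B, f' x ⬝ᵥ u x) - ∫ x in B, g' ⬝ᵥ c x := by
  obtain ⟨ρ, hρ⟩ := hBb.subset_ball (0 : Pt)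
  obtain ⟨C, -, hC⟩ := exists_integral_shellDensity_le
  obtain ⟨K, hK⟩ := h.exists_shellEnergy_le hBo hBb hBn hκ hf
  obtain ⟨K', hK'⟩ := h'.exists_shellEnergy_le hBo hBb hBn hκ hf'
  have hu := h.hasWeakCurl hBo hBn
  have hu' := h'.hasWeakCurl hBo hBn
  set L : ℂ := (∫ x in B, f x ⬝ᵥ u' x) - ∫ x in B, g ⬝ᵥ c' x
  set L' : ℂ := (∫ x in B, f' x ⬝ᵥ u x) - ∫ x in B, g' ⬝ᵥ c x
  -- For fixed `δ` one sufficiently large `R` is enough, since the left side does not involve `R`.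
  have key : ∀ δ : ℝ, 0 < δ → ‖L - L'‖ ≤ δ * (K + K' + 2 * C) := fun δ hδ => by
    obtain ⟨R, hV, hV', hKR, hKR', hρR, hR⟩ :=
      ((h.radiation.eventually_norm_integral_le hC hδ).and
        ((h'.radiation.eventually_norm_integral_le hC hδ).and
          (hK.and (hK'.and ((eventually_ge_atTop ρ).and (eventually_gt_atTop 0)))))).exists
    have h1 := h.cutoff_weak_form hBo hBn hρ hf hu' hR hρR
    have h2 := h'.cutoff_weak_form hBo hBn hρ hf' hu hR hρR
    rw [integral_dotProduct_grad_cutoff_cross κ hR hu.field_L2 hu.curl_L2 hu'.field_L2] at h1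
    rw [integral_dotProduct_grad_cutoff_cross κ hR hu'.field_L2 hu'.curl_L2 hu.field_L2] at h2
    -- After this swap both identities contain the same bulk integral and the same `iκ` shell
    -- integral, so only the two radiation remainders survive subtraction.
    simp only [energyDensity_comm B κ μr εr u' c' u c, dotProduct_comm (u _) (u' _)] at h2
    have h3 : L - L' = (∫ x, (shellDensity R x : ℂ) * (u x ⬝ᵥ radiationField κ u' c' x))
        - ∫ x, (shellDensity R x : ℂ) * (u' x ⬝ᵥ radiationField κ u c x) := by
      linear_combination h2 - h1
    rw [h3]
    have b1 := hV _ hu'.field_L2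
    have b2 := hV' _ hu.field_L2
    have b3 := mul_le_mul_of_nonneg_left hKR hδ.le
    have b4 := mul_le_mul_of_nonneg_left hKR' hδ.le
    refine (norm_sub_le _ _).trans ?_
    linarith
  refine sub_eq_zero.mp (norm_le_zero_iff.mp (le_of_forall_pos_le_add fun η hη => ?_))
  -- Absolute value and `+ 1` make the divisor positive whatever the sign of the bound.
  have hM : 0 < |K + K' + 2 * C| + 1 := by positivity
  refine (key (η / (|K + K' + 2 * C| + 1)) (by positivity)).trans ?_
  rw [zero_add, div_mul_eq_mul_div, div_le_iff₀ hM]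
  exact mul_le_mul_of_nonneg_left ((le_abs_self _).trans (by linarith)) hη.le

/-! ### Symmetry of the polarizability tensor -/

theorem LocL2.integrableOn_of_isBounded {B : Set Pt} (hBb : Bornology.IsBounded B) {F : VField}
    (hF : LocL2 Set.univ F) : IntegrableOn F B := by
  obtain ⟨ρ, hρ⟩ := hBb.subset_ball (0 : Pt)
  have : IsFiniteMeasure (volume.restrict (Set.univ ∩ Metric.ball (0 : Pt) ρ)) :=
    ⟨by
      rw [Measure.restrict_apply_univ, Set.univ_inter]
      exact measure_ball_lt_top⟩
  have h : IntegrableOn F (Set.univ ∩ Metric.ball (0 : Pt) ρ) :=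
    (hF ρ).integrable one_le_two
  exact h.mono_set fun x hx => ⟨trivial, hρ hx⟩

theorem dotProduct_integral {B : Set Pt} {F : VField} (hF : IntegrableOn F B) (a : CVec) :
    a ⬝ᵥ ∫ x in B, F x = ∫ x in B, a ⬝ᵥ F x := by
  simp only [dotProduct]
  rw [integral_finsetSum _ fun j _ => (hF.eval j).const_mul _]
  refine Finset.sum_congr rfl fun j _ => ?_
  rw [integral_const_mul, eval_integral fun i => hF.eval i]

theorem contDiff_vec : ContDiff ℝ ∞ vec :=
  contDiff_pi.mpr fun j =>
    Complex.ofRealCLM.contDiff.comp (EuclideanSpace.proj j : Pt →L[ℝ] ℝ).contDiff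

theorem continuous_vec : Continuous vec := contDiff_vec.continuous

theorem continuous_cross_vec (a : CVec) : Continuous fun x => a ⨯₃ vec x :=
  continuous_cross.comp (continuous_const.prodMk continuous_vec)

theorem tensorM_symm {B : Set Pt} (hBo : IsOpen B) (hBb : Bornology.IsBounded B)
    (hBn : volume (frontier B) = 0) {k α μr : ℝ} {εr : ℂ} (hk : 0 < k) (hα : 0 < α)
    {θ cθ : Fin 3 → VField} (hθ : ∀ i, SolvesTheta B k α μr εr i (θ i) (cθ i)) (r i : Fin 3) :
    tensorM B k α μr εr θ cθ r i = tensorM B k α μr εr θ cθ i r := by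
  have hX : ∀ i, LocL2 Set.univ fun ξ => e i ⨯₃ vec ξ := fun i =>
    LocL2.of_continuous .univ (continuous_cross_vec (e i))
  have hf : ∀ i, LocL2 Set.univ fun ξ =>
      (-((k : ℂ) ^ 2 * (α : ℂ) ^ 2 * (1 - εr))) • (e i ⨯₃ vec ξ) := fun i =>
    (hX i).smul .univ continuous_const
  have hw := fun i => (hθ i).hasWeakCurl hBo hBn
  -- The first two terms are symmetric in `r` and `i`. The last bracket is exactly one side of the
  -- reciprocity relation, as the source of the problem is `ν e_r × ξ` and its jump vector is `-2 (1
  -- - μr⁻¹) e_r`.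
  have hform : ∀ r i, tensorM B k α μr εr θ cθ r i
      = (α : ℂ) ^ 3 * (1 - (μr : ℂ)⁻¹) * (∫ _ξ in B, e r ⬝ᵥ e i)
        + nu k α εr * (α : ℂ) ^ 3 / 4 * (∫ ξ in B, (e i ⨯₃ vec ξ) ⬝ᵥ (e r ⨯₃ vec ξ))
        + (α : ℂ) ^ 3 / 4 *
          ((∫ ξ in B, ((-((k : ℂ) ^ 2 * (α : ℂ) ^ 2 * (1 - εr))) • (e r ⨯₃ vec ξ)) ⬝ᵥ θ i ξ)
            - ∫ ξ in B, ((-2 * (1 - (μr : ℂ)⁻¹)) • e r) ⬝ᵥ cθ i ξ) := fun r i => by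
    have hN : e r ⬝ᵥ ∫ ξ in B, (e i + (1 / 2 : ℂ) • cθ i ξ)
        = (∫ _ξ in B, e r ⬝ᵥ e i) + 1 / 2 * ∫ ξ in B, e r ⬝ᵥ cθ i ξ := by
      have i1 : IntegrableOn (fun _ : Pt => e r ⬝ᵥ e i) B :=
        integrableOn_const hBb.measure_lt_top.ne
      have i2 : IntegrableOn (fun ξ => e r ⬝ᵥ cθ i ξ) B :=
        ((LocL2.of_continuous .univ continuous_const).mono
          (Set.subset_univ B)).integrableOn_dotProduct_of_isBounded hBb
          ((hw i).curl_L2.mono (Set.subset_univ B))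
      have i3 : IntegrableOn (fun ξ => e i + (1 / 2 : ℂ) • cθ i ξ) B :=
        LocL2.integrableOn_of_isBounded hBb <|
          (LocL2.of_continuous .univ continuous_const).add
            ((hw i).curl_L2.smul .univ continuous_const)
      rw [dotProduct_integral i3, ← integral_const_mul, ← integral_add i1 (i2.const_mul _)]
      simp only [dotProduct_add, dotProduct_smul, smul_eq_mul]
    have hC : e r ⬝ᵥ ∫ ξ in B, vec ξ ⨯₃ (θ i ξ + e i ⨯₃ vec ξ)
        = (∫ ξ in B, (e r ⨯₃ vec ξ) ⬝ᵥ θ i ξ)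
          + ∫ ξ in B, (e i ⨯₃ vec ξ) ⬝ᵥ (e r ⨯₃ vec ξ) := by
      have i1 : IntegrableOn (fun ξ => (e r ⨯₃ vec ξ) ⬝ᵥ θ i ξ) B :=
        ((hX r).mono (Set.subset_univ B)).integrableOn_dotProduct_of_isBounded hBb
          ((hw i).field_L2.mono (Set.subset_univ B))
      have i2 : IntegrableOn (fun ξ => (e i ⨯₃ vec ξ) ⬝ᵥ (e r ⨯₃ vec ξ)) B :=
        ((hX i).mono (Set.subset_univ B)).integrableOn_dotProduct_of_isBounded hBb
          ((hX r).mono (Set.subset_univ B))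
      have i3 : IntegrableOn (fun ξ => vec ξ ⨯₃ (θ i ξ + e i ⨯₃ vec ξ)) B :=
        LocL2.integrableOn_of_isBounded hBb <|
          ((hw i).field_L2.add (hX i)).cross_left .univ continuous_vec
      rw [dotProduct_integral i3, ← integral_add i1 i2]
      refine integral_congr_ae (Eventually.of_forall fun ξ => ?_)
      simp only
      rw [triple_product_permutation, triple_product_permutation, add_dotProduct,
        dotProduct_comm (θ i ξ)]
    rw [tensorM, tensorN, tensorCCheck, hN, hC]
    simp only [smul_dotProduct, smul_eq_mul, integral_const_mul, nu]
    ring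
  have hrec := (hθ r).reciprocity hBo hBb hBn (mul_pos hk hα) (hθ i) (hf r) (hf i)
  rw [hform r i, hform i r, hrec]
  simp only [dotProduct_comm (e r) (e i), dotProduct_comm (e i ⨯₃ vec _) (e r ⨯₃ vec _)]

end SmallObject

end

theorem mainTheorem2 (B : Set SmallObject.Pt) (hBo : IsOpen B) (hBb : Bornology.IsBounded B)
    (hBn : volume (frontier B) = 0)
    (k α μr : ℝ) (εr : ℂ) (hk : 0 < k) (hα : 0 < α) (hμ : 0 < μr) (hε : 0 < εr.re)
    (hε' : 0 ≤ εr.im)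
    (θ cθ : Fin 3 → SmallObject.VField)
    (hθ : ∀ i, SmallObject.SolvesTheta B k α μr εr i (θ i) (cθ i)) :
    (∀ r i, SmallObject.tensorM B k α μr εr θ cθ r i
      = SmallObject.tensorM B k α μr εr θ cθ i r) ∧
    ∀ φ cφ : Fin 3 → SmallObject.VField,
      (∀ i, SmallObject.SolvesPhi B k α μr εr i (φ i) (cφ i)) →
      ∀ (z x : SmallObject.Pt), x ≠ z → ∀ H E HΔ R : SmallObject.CVec,
        (HΔ = SmallObject.expansion k x z
            (SmallObject.tensorA B k α εr θ) (SmallObject.tensorB B α εr φ)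
            (SmallObject.tensorC B k α εr θ) (SmallObject.tensorN B α μr cθ) H E + R ↔
          HΔ = SmallObject.dipoleForm k x z
            (SmallObject.tensorA B k α εr θ) (SmallObject.tensorB B α εr φ)
            (SmallObject.tensorM B k α μr εr θ cθ) H E
            + (R + SmallObject.restTerm k x z (SmallObject.tensorRest B k α εr θ) H)) := by
  refine ⟨SmallObject.tensorM_symm hBo hBb hBn hk hα hθ, fun φ cφ _ z x hxz H E HΔ R => ?_⟩
  -- The two right-hand sides are equal as vectors, so the equivalence becomes reflexive.
  rw [SmallObject.expansion_eq_dipoleForm_add_restTerm B k α μr εr θ cθ φ hxz H E, add_assoc,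
    add_comm (SmallObject.restTerm _ _ _ _ _) R]
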